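/- **Problem.** Let $f=f_1+f_2$, $g=g_1+g_2$ on $\mathbb R^n$ (Euclidean norm), where $f_1,g_1:\mathbb R^n\to\mathbb R$ are convex and $C^1$ with $L_{f_1}$- and $L_{g_1}$-Lipschitz gradients, and $f_2,g_2:\mathbb R^n\to\mathbb R\cup\{+\infty\}$ are proper, lower semicontinuous and convex, $f_2$ being $l_{f_2}$-Lipschitz on $\mathrm{dom}\,f_2$. Put $X=\mathrm{dom} f\cap\mathrm{dom} g$, $f^*=\inf_X f$, $g^*=\inf_{\mathbb R^n} g$, $p^*=\inf\{f(x):x\in\arg\min g\}$. Assume $f^*>-\infty$, $\inf_X g>-\infty$, $p^*-f^*\ge\Delta$ for some $\Delta>0$, and that $\arg\min g$ has more than one point. **Subproblem.** For $\epsilon>0$, $c\in\mathbb R$ and a point $x^0$ put $f_c=f_1-c+f_2$, $g_\epsilon=g_1+\frac\epsilon2\|\cdot-x^0\|^2$, and consider $\min\, g_\epsilon(x)+g_2(x)$ s.t. $f_c(x)\le 0$, with Lagrangian $\mathcal L^\epsilon(x,z)=g_\epsilon(x)+g_2(x)+z f_c(x)$ (with $0\cdot\infty=0$). A point $x$ is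 a $\delta$-KKT point if for some $z\ge0$: $\mathrm{dist}(0,\partial_x\mathcal L^\epsilon(x,z))\le\delta$, $[f_c(x)]_+\le\delta$ and $|z f_c(x)|\le\delta$. **Points and constants.** Let $\Delta_1>0$. Let $g(x^0)<\infty$ and $f_c(x^0)<-\Delta_1$; let $\tilde x_g$ satisfy $f(\tilde x_g)<\infty$, $g(\tilde x_g)\le g^*+\epsilon$; let $u_0=f(\tilde x_g)$ and $c\le u_0$. Put $D_z=(g(x^0)-g(\tilde x_g)+1)/\Delta_1$, $L=L_{g_1}+2D_zL_{f_1}+1$, $D_0=g(x^0)+\max\{0,-2D_zf^*\}+2D_z|u_0|$, $R_1=\mathrm{diam}\,\mathrm{Lev}_g(D_0)$, $D_{\mathcal L_z}=D_0+\gamma_1LR_1^2$, $D_g=\mathrm{diam}\,\mathrm{Lev}_g(D_{\mathcal L_z})$, $B_f=\max_{\mathrm{Lev}_g(D_{\mathcal L_z})}\|\nabla f_1\|+l_{f_2}$, where $\mathrm{Lev}_g(t)=\{x: g(x)\le t\}$ and both level sets are assumed bounded. Tolerances: $\epsilon_1=\epsilon_4=\epsilon^2$, $\epsilon_2=B_f\epsilon$,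 $\epsilon_3=(2D_zB_f+2D_zB_f^2)\epsilon$. **Inner method.** For $z\ge0$, $\mathrm{APG}_z(y_0)$ is the following accelerated proximal gradient method for $\varphi=\varphi_1+\varphi_2$, $\varphi_1=g_\epsilon+zf_1$, $\varphi_2=g_2+zf_2$, with parameters $L_{\min}>0$, $\gamma_1>1$, $\gamma_2\ge1$ and $\mu=\epsilon$. Write $T_{M}(y)=\mathrm{prox}_{\varphi_2/M}(y-\nabla\varphi_1(y)/M)$ and call $M$ acceptable at $y$ if $x=T_M(y)$ satisfies $\varphi_1(x)\le\varphi_1(y)+\langle\nabla\varphi_1(y),x-y\rangle+\frac M2\|x-y\|^2$. A line search from $M$ tries $M,\gamma_1M,\gamma_1^2M,\dots$ until an acceptable value is found. First, search from $L_{\min}$ at $y_0$, giving $\tilde L$; set $x_{-1}=x_0=T_{\tilde L}(y_0)$, $L_0=\max\{L_{\min},\tilde L/\gamma_2\}$, $\alpha_{-1}=1$. For $k=0,1,\dots$: search from $L_k$, where the trial value $M$ is tested at $y=x_k+\frac{\alpha(1-\alpha_{k-1})}{\alpha_{k-1}(1+\alpha)}(x_k-x_{k-1})$, $\alpha=\sqrt{\mu/M}$;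 this gives $\tilde L$, the point $x_{k+1}=T_{\tilde L}(y)$ and $\alpha_k=\sqrt{\mu/\tilde L}$. Then search from $\tilde L$ at $x_{k+1}$, giving $\hat L$ and $\hat x=T_{\hat L}(x_{k+1})$; put $L_{k+1}=\max\{L_{\min},\tilde L/\gamma_2\}$. Stop and return $\hat x$ if $\mathrm{dist}(0,\partial\varphi(\hat x))\le\epsilon_1$. **Interval search** (for the value $c$, with $0<\sigma\le 2D_z$ and an initial point). Let $\hat x=\mathrm{APG}_0$(initial point); if $[f_c(\hat x)]_+\le\epsilon_2$ return $Z=\{0\}$. Otherwise let $a=0$, $b=\sigma$, $\hat x\leftarrow\mathrm{APG}_b(\hat x)$; while $[f_c(\hat x)]_+>\epsilon_2$ and $b\le D_z$ let $a=b$, $b\leftarrow2b$, $\hat x\leftarrow\mathrm{APG}_b(\hat x)$. Return $Z=\{b\}$ if $|bf_c(\hat x)|\le\epsilon_3$, and $Z=[a,b]$ otherwise; the last $\hat x$ is kept as $\hat x_b$. **Dual bisection** (on $Z=[a,b]$ with the point $\hat x_b$, and with an initial point $\hat x$). While $b-a>\epsilon_4$: let $e=\frac{a+b}2$, $\hat x\leftarrow\mathrm{APG}_e(\hat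 x)$; if $[f_c(\hat x)]_+>\epsilon_2$ let $a=e$; else if $|ef_c(\hat x)|\le\epsilon_3$ return $(\hat x,e)$; else let $b=e$, $\hat x_b=\hat x$. After the loop return $(\hat x_b,b)$. Here $Z$ is the output of the interval search for $c$, or $Z=[0,\max Z']$ where $Z'$ is the output of the interval search for some $c'\le c$ with $f_{c'}(x^0)<-\Delta_1$; $\hat x_b$ is the point computed there for $b=\max Z$. Initial points of both procedures lie in $\mathrm{Lev}_g(D_{\mathcal L_z})$. **Lemma 7.** For all $L_{\min}>0$, $\gamma_1>1$, $\gamma_2\ge1$ there is a constant $C>0$, depending only on these three numbers, such that the following holds. For all $f_1,f_2,g_1,g_2$ as above, all $\Delta_1>0$ and all $D$ there is $\epsilon_0\in(0,1]$ such that for all $\epsilon\in(0,\epsilon_0)$ and all $x^0,\tilde x_g,c$ as above with $D_z\le D$ and $D_g\le D$: the interval search halts, the dual bisection halts, and the pair $(\hat x,\hat z)$ returned by the dual bisection satisfies the $\bar\epsilon$-KKT conditions of the subproblem with $\bar\epsilon=\max\{\epsilon_2,\epsilon_3\}$ (so $\hat x$ is an $\bar\epsilon$-KKT point); moreover the dual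 bisection makes at most $$C\sqrt{\frac{L_{g_1}+2D_zL_{f_1}+1}{\epsilon}}\;|\log\epsilon|^2$$ oracle queries, a query being one evaluation of a function value, of a gradient, or of a proximal mapping (every pass of every line search and every stopping test being counted). -/

import Mathlib

open scoped NNReal ENNReal

noncomputable section

/-- The space `ℝⁿ` with its Euclidean norm. -/
abbrev Eucl (n : ℕ) : Type := EuclideanSpace ℝ (Fin n)

/-! ### Convex analysis of extended-real-valued functions -/

/-- Proper, lower semicontinuous and convex (convexity through the epigraph). -/
structure ProperLscConvex {n : ℕ} (φ : Eucl n → EReal) : Prop where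
  ne_bot : ∀ x, φ x ≠ ⊥
  exists_ne_top : ∃ x, φ x ≠ ⊤
  lsc : LowerSemicontinuous φ
  convex_epi : Convex ℝ {p : Eucl n × ℝ | φ p.1 ≤ (p.2 : EReal)}

/-- Effective domain. -/
def effDom {n : ℕ} (φ : Eucl n → EReal) : Set (Eucl n) := {x | φ x < ⊤}

/-- Level set `Lev_φ(t)`. -/
def levSet {n : ℕ} (φ : Eucl n → EReal) (t : ℝ) : Set (Eucl n) := {x | φ x ≤ (t : EReal)}

/-- The subdifferential of convex analysis. -/
def subdiff {n : ℕ} (φ : Eucl n → EReal) (x : Eucl n) : Set (Eucl n) :=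
  {v | ∀ y, φ x + ((inner ℝ v (y - x) : ℝ) : EReal) ≤ φ y}

/-- `dist(0, ∂φ(x)) ≤ ε`; the distance to the empty set is `∞`. -/
def NearStationary {n : ℕ} (φ : Eucl n → EReal) (ε : ℝ) (x : Eucl n) : Prop :=
  Metric.infEDist 0 (subdiff φ x) ≤ ENNReal.ofReal ε

/-- `x = prox_{t ψ}(y)`, that is, `x` minimizes `ψ(u) + ‖u - y‖² / (2t)` over `u ∈ ℝⁿ`. -/
def IsProx {n : ℕ} (t : ℝ) (ψ : Eucl n → EReal) (y x : Eucl n) : Prop :=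
  IsMinOn (fun u => ψ u + ((1 / (2 * t) * ‖u - y‖ ^ 2 : ℝ) : EReal)) Set.univ x

/-! ### The accelerated proximal gradient method for `φ₁ + φ₂`, `φ₁` smooth and `μ`-strongly convex

Programs are described by their terminating runs, with the number of oracle queries in the run. -/

/-- Parameters of the method: minimum Lipschitz constant, increase rate, decrease rate. -/
structure APGParams where
  Lmin : ℝ
  γ₁ : ℝ
  γ₂ : ℝ

/-- The proximal gradient step `x = prox_{φ₂ / L}(y - ∇φ₁(y) / L)`. -/
def IsProxStep {n : ℕ} (φ₁ : Eucl n → ℝ) (φ₂ : Eucl n → EReal) (L : ℝ) (y x : Eucl n) : Prop :=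
  IsProx (1 / L) φ₂ (y - (1 / L) • gradient φ₁ y) x

/-- The acceptance test of the line searches. -/
def DescentTest {n : ℕ} (φ₁ : Eucl n → ℝ) (L : ℝ) (y x : Eucl n) : Prop :=
  φ₁ x ≤ φ₁ y + inner ℝ (gradient φ₁ y) (x - y) + L / 2 * ‖x - y‖ ^ 2

/-- `LineSearch φ₁ φ₂ γ₁ y L L' x' m`: the `repeat` loop whose first trial value is `L`, which
multiplies the trial value by `γ₁` after each failed test, and whose base point is `y L` for the
trial value `L`, stops with the value `L'` and the point `x'` after `m` passes. -/
inductive LineSearch {n : ℕ} (φ₁ : Eucl n → ℝ) (φ₂ : Eucl n → EReal) (γ₁ : ℝ) (y : ℝ → Eucl n) :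
    ℝ → ℝ → Eucl n → ℕ → Prop
  | accept (L : ℝ) (x : Eucl n) (hx : IsProxStep φ₁ φ₂ L (y L) x)
      (ht : DescentTest φ₁ L (y L) x) : LineSearch φ₁ φ₂ γ₁ y L L x 1
  | reject (L : ℝ) (x : Eucl n) (L' : ℝ) (x' : Eucl n) (m : ℕ)
      (hx : IsProxStep φ₁ φ₂ L (y L) x) (ht : ¬ DescentTest φ₁ L (y L) x)
      (hrest : LineSearch φ₁ φ₂ γ₁ y (γ₁ * L) L' x' m) : LineSearch φ₁ φ₂ γ₁ y L L' x' (m + 1)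

/-- The extrapolated point `ỹ = x_k + α_k(1-α_{k-1}) / (α_{k-1}(1+α_k)) (x_k - x_{k-1})` with
`α_k = √(μ / L)`. -/
def extrapolate {n : ℕ} (μ : ℝ) (xprev x : Eucl n) (αprev L : ℝ) : Eucl n :=
  x + ((√(μ / L) * (1 - αprev)) / (αprev * (1 + √(μ / L)))) • (x - xprev)

/-- One iteration of the outer loop from the state `(x_{k-1}, x_k, α_{k-1}, L_k)`, up to the
stopping test: `Lt`, `xt` are `L̃`, `x̃`, and `xh` is `x̂`. Every individual evaluation is counted as
an oracle query: a pass of a line search costs four (two values of `φ₁`, one gradient, one proximal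
mapping), and the stopping test at `x̂` costs two (the gradient of `φ₁` and the term `φ₂`). -/
def APGIteration {n : ℕ} (φ₁ : Eucl n → ℝ) (φ₂ : Eucl n → EReal) (prm : APGParams) (μ : ℝ)
    (xprev x : Eucl n) (αprev L : ℝ) (Lt : ℝ) (xt xh : Eucl n) (N : ℕ) : Prop :=
  ∃ (Lh : ℝ) (m₁ m₂ : ℕ),
    LineSearch φ₁ φ₂ prm.γ₁ (extrapolate μ xprev x αprev) L Lt xt m₁ ∧
    LineSearch φ₁ φ₂ prm.γ₁ (fun _ => xt) Lt Lh xh m₂ ∧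
    N = 4 * m₁ + 4 * m₂ + 2

/-- The outer loop of the method, from the state `(x_{k-1}, x_k, α_{k-1}, L_k)` to the returned
point, with the number of oracle queries. -/
inductive APGLoop {n : ℕ} (φ₁ : Eucl n → ℝ) (φ₂ : Eucl n → EReal) (prm : APGParams) (μ ε : ℝ) :
    Eucl n → Eucl n → ℝ → ℝ → Eucl n → ℕ → Prop
  | finish (xprev x : Eucl n) (αprev L Lt : ℝ) (xt xh : Eucl n) (N : ℕ)
      (hit : APGIteration φ₁ φ₂ prm μ xprev x αprev L Lt xt xh N)
      (hs : NearStationary (fun u => (φ₁ u : EReal) + φ₂ u) ε xh) :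
      APGLoop φ₁ φ₂ prm μ ε xprev x αprev L xh N
  | next (xprev x : Eucl n) (αprev L Lt : ℝ) (xt xh : Eucl n) (N : ℕ) (xout : Eucl n) (N' : ℕ)
      (hit : APGIteration φ₁ φ₂ prm μ xprev x αprev L Lt xt xh N)
      (hs : ¬ NearStationary (fun u => (φ₁ u : EReal) + φ₂ u) ε xh)
      (hrest : APGLoop φ₁ φ₂ prm μ ε x xt (√(μ / Lt)) (max prm.Lmin (Lt / prm.γ₂)) xout N') :
      APGLoop φ₁ φ₂ prm μ ε xprev x αprev L xout (N + N')

/-- `APG φ₁ φ₂ prm μ ε y₀ xout N`: started at `y₀` with tolerance `ε`, the method stops and returns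
`xout` after `N` oracle queries. -/
def APG {n : ℕ} (φ₁ : Eucl n → ℝ) (φ₂ : Eucl n → EReal) (prm : APGParams) (μ ε : ℝ)
    (y₀ xout : Eucl n) (N : ℕ) : Prop :=
  ∃ (Lt : ℝ) (xt : Eucl n) (m N' : ℕ),
    LineSearch φ₁ φ₂ prm.γ₁ (fun _ => y₀) prm.Lmin Lt xt m ∧
    APGLoop φ₁ φ₂ prm μ ε xt xt 1 (max prm.Lmin (Lt / prm.γ₂)) xout N' ∧
    N = 4 * m + N'

/-! ### The simple bilevel problem -/

/-- Data of the problem: minimize `f = f₁ + f₂` over the minimizers of `g = g₁ + g₂`, with the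
Lipschitz constants of `∇f₁`, `∇g₁` and of `f₂`. -/
structure Bilevel (n : ℕ) where
  f₁ : Eucl n → ℝ
  g₁ : Eucl n → ℝ
  f₂ : Eucl n → EReal
  g₂ : Eucl n → EReal
  Lf₁ : ℝ≥0
  Lg₁ : ℝ≥0
  lf₂ : ℝ≥0

namespace Bilevel

variable {n : ℕ} (P : Bilevel n)

/-- Upper-level objective. -/
def f (x : Eucl n) : EReal := (P.f₁ x : EReal) + P.f₂ x

/-- Lower-level objective. -/
def g (x : Eucl n) : EReal := (P.g₁ x : EReal) + P.g₂ x

/-- The common domain `X`. -/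
def X : Set (Eucl n) := effDom P.f ∩ effDom P.g

/-- `f* = inf_X f`. -/
def fStar : EReal := ⨅ x ∈ P.X, P.f x

/-- Optimal value `g*` of the lower-level problem `min g` over `ℝⁿ`. -/
def gStar : EReal := ⨅ x, P.g x

/-- Optimal solution set of the lower-level problem. -/
def argminG : Set (Eucl n) := {x | P.g x < ⊤ ∧ IsMinOn P.g Set.univ x}

/-- Optimal value `p*` of the bilevel problem. -/
def pStar : EReal := ⨅ x ∈ P.argminG, P.f x

/-- The basic assumptions on the bilevel problem. -/
structure BasicAssumption : Prop where
  convex_f₁ : ConvexOn ℝ Set.univ P.f₁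
  convex_g₁ : ConvexOn ℝ Set.univ P.g₁
  contDiff_f₁ : ContDiff ℝ 1 P.f₁
  contDiff_g₁ : ContDiff ℝ 1 P.g₁
  lipschitz_f₁ : LipschitzWith P.Lf₁ (gradient P.f₁)
  lipschitz_g₁ : LipschitzWith P.Lg₁ (gradient P.g₁)
  plc_f₂ : ProperLscConvex P.f₂
  plc_g₂ : ProperLscConvex P.g₂
  lipschitz_f₂ : LipschitzOnWith P.lf₂ (fun x => (P.f₂ x).toReal) (effDom P.f₂)
  bddBelow_f : ⊥ < P.fStar
  bddBelow_g : ⊥ < ⨅ x ∈ P.X, P.g x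
  gap : ∃ Δ : ℝ, 0 < Δ ∧ P.fStar + (Δ : EReal) ≤ P.pStar
  /-- The lower-level problem is solvable, with more than one solution. -/
  argminG_nontrivial : P.argminG.Nontrivial

/-! #### The perturbed subproblem `min G_ε(x)` subject to `f_c(x) ≤ 0` -/

/-- `f_c = f₁ - c + f₂`. -/
def fc (c : ℝ) (x : Eucl n) : EReal := ((P.f₁ x - c : ℝ) : EReal) + P.f₂ x

/-- `g_ε = g₁ + (ε/2) ‖· - x⁰‖²`. -/
def gEps (x0 : Eucl n) (ε : ℝ) (x : Eucl n) : ℝ := P.g₁ x + ε / 2 * ‖x - x0‖ ^ 2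

/-- `L^ε(x, z) = G_ε(x) + z f_c(x)` with `G_ε = g_ε + g₂` (and `0 · ∞ = 0`). -/
def lagr (x0 : Eucl n) (ε c z : ℝ) (x : Eucl n) : EReal :=
  (P.gEps x0 ε x : EReal) + P.g₂ x + (z : EReal) * P.fc c x

/-- The `δ`-KKT conditions of the subproblem for the point `x` and the multiplier `z ≥ 0`. -/
def KKTConditions (x0 : Eucl n) (ε c δ : ℝ) (x : Eucl n) (z : ℝ) : Prop :=
  0 ≤ z ∧ NearStationary (P.lagr x0 ε c z) δ x ∧
    max (P.fc c x) 0 ≤ (δ : EReal) ∧ ((z : EReal) * P.fc c x).abs ≤ ENNReal.ofReal δ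

/-- `x` is a `δ`-KKT point of the subproblem. -/
def IsKKTPoint (x0 : Eucl n) (ε c δ : ℝ) (x : Eucl n) : Prop :=
  ∃ z : ℝ, P.KKTConditions x0 ε c δ x z

/-! #### The constants; `x0` is the center `x⁰` of the perturbation and `xg` is the approximate
solution `x̃_g` of the lower-level problem -/

/-- `D_z = (g(x⁰) - g(x̃_g) + 1) / Δ₁`. -/
def Dz (x0 xg : Eucl n) (Δ₁ : ℝ) : ℝ := ((P.g x0).toReal - (P.g xg).toReal + 1) / Δ₁

/-- `u₀ = f(x̃_g)`. -/
def u₀ (xg : Eucl n) : ℝ := (P.f xg).toReal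

/-- `L_{φ₁} = L_{g₁} + 2 D_z L_{f₁} + 1`. -/
def Lφ (x0 xg : Eucl n) (Δ₁ : ℝ) : ℝ := P.Lg₁ + 2 * P.Dz x0 xg Δ₁ * P.Lf₁ + 1

/-- `D_0 = g(x⁰) + max{0, -2 D_z f*} + 2 D_z |u₀|`. -/
def D₀ (x0 xg : Eucl n) (Δ₁ : ℝ) : ℝ :=
  (P.g x0).toReal + max 0 (-2 * P.Dz x0 xg Δ₁ * P.fStar.toReal) + 2 * P.Dz x0 xg Δ₁ * |P.u₀ xg|

/-- `R₁`, the diameter of `Lev_g(D_0)`. -/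
def R₁ (x0 xg : Eucl n) (Δ₁ : ℝ) : ℝ := Metric.diam (levSet P.g (P.D₀ x0 xg Δ₁))

/-- `D_{L_z} = D_0 + γ₁ L_{φ₁} R₁²`. -/
def DL (γ₁ : ℝ) (x0 xg : Eucl n) (Δ₁ : ℝ) : ℝ :=
  P.D₀ x0 xg Δ₁ + γ₁ * P.Lφ x0 xg Δ₁ * P.R₁ x0 xg Δ₁ ^ 2

/-- `Lev_g(D_{L_z})`. -/
def levDL (γ₁ : ℝ) (x0 xg : Eucl n) (Δ₁ : ℝ) : Set (Eucl n) := levSet P.g (P.DL γ₁ x0 xg Δ₁)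

/-- `D_g`, the diameter of `Lev_g(D_{L_z})`. -/
def Dg (γ₁ : ℝ) (x0 xg : Eucl n) (Δ₁ : ℝ) : ℝ := Metric.diam (P.levDL γ₁ x0 xg Δ₁)

/-- `B_f = max_{Lev_g(D_{L_z})} ‖∇f₁‖ + l_{f₂}`. -/
def Bf (γ₁ : ℝ) (x0 xg : Eucl n) (Δ₁ : ℝ) : ℝ :=
  sSup ((fun x => ‖gradient P.f₁ x‖) '' P.levDL γ₁ x0 xg Δ₁) + P.lf₂

/-! #### The two algorithms for the dual problem -/

/-- The call `APG(g_ε + z f₁, g₂ + z f₂)` with strong convexity parameter `ε` and tolerance `ε₁`. -/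
def SubAPG (prm : APGParams) (x0 : Eucl n) (ε ε₁ z : ℝ) (y₀ xout : Eucl n) (N : ℕ) : Prop :=
  APG (fun x => P.gEps x0 ε x + z * P.f₁ x) (fun x => P.g₂ x + (z : EReal) * P.f₂ x)
    prm ε ε₁ y₀ xout N

/-- The `while` loop of the interval search (`Dz` is the bound in its test), from `(a, b, x̂)` to
the values of `(a, b, x̂)` on exit. -/
inductive IntVLoop (prm : APGParams) (x0 : Eucl n) (ε c Dz ε₁ ε₂ : ℝ) :
    ℝ → ℝ → Eucl n → ℝ → ℝ → Eucl n → Prop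
  | exit (a b : ℝ) (x : Eucl n) (h : ¬ ((ε₂ : EReal) < max (P.fc c x) 0 ∧ b ≤ Dz)) :
      IntVLoop prm x0 ε c Dz ε₁ ε₂ a b x a b x
  | step (a b : ℝ) (x x' : Eucl n) (N : ℕ) (a' b' : ℝ) (xout : Eucl n)
      (h : (ε₂ : EReal) < max (P.fc c x) 0 ∧ b ≤ Dz)
      (hcall : P.SubAPG prm x0 ε ε₁ (2 * b) x x' N)
      (hrest : IntVLoop prm x0 ε c Dz ε₁ ε₂ b (2 * b) x' a' b' xout) :
      IntVLoop prm x0 ε c Dz ε₁ ε₂ a b x a' b' xout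

/-- `IntV … σ w a b xb`: the interval search with initial interval `[0, σ]` and initial point `w`
stops and returns `Z = [a, b]` (with `a = b` when it returns a singleton); `xb` is the last `x̂`,
the one computed for the multiplier `b`. -/
inductive IntV (prm : APGParams) (x0 : Eucl n) (ε c Dz ε₁ ε₂ ε₃ σ : ℝ) (w : Eucl n) :
    ℝ → ℝ → Eucl n → Prop
  | zero (x : Eucl n) (N : ℕ) (hcall : P.SubAPG prm x0 ε ε₁ 0 w x N)
      (h : max (P.fc c x) 0 ≤ (ε₂ : EReal)) :
      IntV prm x0 ε c Dz ε₁ ε₂ ε₃ σ w 0 0 x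
  | singleton (x x' : Eucl n) (N N' : ℕ) (a b : ℝ) (xb : Eucl n)
      (hcall : P.SubAPG prm x0 ε ε₁ 0 w x N) (h : ¬ max (P.fc c x) 0 ≤ (ε₂ : EReal))
      (hcall' : P.SubAPG prm x0 ε ε₁ σ x x' N')
      (hloop : IntVLoop P prm x0 ε c Dz ε₁ ε₂ 0 σ x' a b xb)
      (hb : ((b : EReal) * P.fc c xb).abs ≤ ENNReal.ofReal ε₃) :
      IntV prm x0 ε c Dz ε₁ ε₂ ε₃ σ w b b xb
  | interval (x x' : Eucl n) (N N' : ℕ) (a b : ℝ) (xb : Eucl n)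
      (hcall : P.SubAPG prm x0 ε ε₁ 0 w x N) (h : ¬ max (P.fc c x) 0 ≤ (ε₂ : EReal))
      (hcall' : P.SubAPG prm x0 ε ε₁ σ x x' N')
      (hloop : IntVLoop P prm x0 ε c Dz ε₁ ε₂ 0 σ x' a b xb)
      (hb : ¬ ((b : EReal) * P.fc c xb).abs ≤ ENNReal.ofReal ε₃) :
      IntV prm x0 ε c Dz ε₁ ε₂ ε₃ σ w a b xb

/-- `Bisec … a b xb x xout zout N`: the bisection on `Z = [a, b]`, where `xb` is the point computed
for the multiplier `b` and `x` is the current `x̂`, stops and returns `(xout, zout)` after `N` oracle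
queries (those of the calls, and one value of each of `f₁`, `f₂` for each test of `f_c(x̂)`). -/
inductive Bisec (prm : APGParams) (x0 : Eucl n) (ε c ε₁ ε₂ ε₃ ε₄ : ℝ) :
    ℝ → ℝ → Eucl n → Eucl n → Eucl n → ℝ → ℕ → Prop
  | ended (a b : ℝ) (xb x : Eucl n) (h : ¬ ε₄ < b - a) :
      Bisec prm x0 ε c ε₁ ε₂ ε₃ ε₄ a b xb x xb b 0
  | left (a b : ℝ) (xb x x' : Eucl n) (N : ℕ) (xout : Eucl n) (zout : ℝ) (N' : ℕ)
      (h : ε₄ < b - a) (hcall : P.SubAPG prm x0 ε ε₁ ((a + b) / 2) x x' N)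
      (hpos : (ε₂ : EReal) < max (P.fc c x') 0)
      (hrest : Bisec prm x0 ε c ε₁ ε₂ ε₃ ε₄ ((a + b) / 2) b xb x' xout zout N') :
      Bisec prm x0 ε c ε₁ ε₂ ε₃ ε₄ a b xb x xout zout (N + 2 + N')
  | found (a b : ℝ) (xb x x' : Eucl n) (N : ℕ)
      (h : ε₄ < b - a) (hcall : P.SubAPG prm x0 ε ε₁ ((a + b) / 2) x x' N)
      (hpos : max (P.fc c x') 0 ≤ (ε₂ : EReal))
      (hcs : ((((a + b) / 2 : ℝ) : EReal) * P.fc c x').abs ≤ ENNReal.ofReal ε₃) :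
      Bisec prm x0 ε c ε₁ ε₂ ε₃ ε₄ a b xb x x' ((a + b) / 2) (N + 2)
  | right (a b : ℝ) (xb x x' : Eucl n) (N : ℕ) (xout : Eucl n) (zout : ℝ) (N' : ℕ)
      (h : ε₄ < b - a) (hcall : P.SubAPG prm x0 ε ε₁ ((a + b) / 2) x x' N)
      (hpos : max (P.fc c x') 0 ≤ (ε₂ : EReal))
      (hcs : ¬ ((((a + b) / 2 : ℝ) : EReal) * P.fc c x').abs ≤ ENNReal.ofReal ε₃)
      (hrest : Bisec prm x0 ε c ε₁ ε₂ ε₃ ε₄ a ((a + b) / 2) x' x' xout zout N') :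
      Bisec prm x0 ε c ε₁ ε₂ ε₃ ε₄ a b xb x xout zout (N + 2 + N')

/-! #### Standing requirements, and the prescribed tolerances -/

/-- Requirements on the points `x⁰`, `x̃_g` and the value `c`: `g(x⁰)` and `f(x̃_g)` are finite,
`x̃_g` is an `ε`-optimal solution of the lower-level problem, `c ≤ u₀`, and the regular condition
`f_c(x⁰) < -Δ₁` holds. -/
structure RegularCondition (x0 xg : Eucl n) (ε c Δ₁ : ℝ) : Prop where
  g_x0 : P.g x0 < ⊤
  f_xg : P.f xg < ⊤
  g_xg : P.g xg ≤ P.gStar + (ε : EReal)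
  c_le : c ≤ P.u₀ xg
  slater : P.fc c x0 < ((-Δ₁ : ℝ) : EReal)

/-- Boundedness of the two level sets of the lower-level objective. -/
structure BoundedLevels (γ₁ : ℝ) (x0 xg : Eucl n) (Δ₁ : ℝ) : Prop where
  bounded_D₀ : Bornology.IsBounded (levSet P.g (P.D₀ x0 xg Δ₁))
  bounded_DL : Bornology.IsBounded (P.levDL γ₁ x0 xg Δ₁)

/-- `ε₁ = ε²` (and `ε₄ = ε²`). -/
def tol₁ (ε : ℝ) : ℝ := ε ^ 2

/-- `ε₂ = B_f ε`. -/
def tol₂ (γ₁ : ℝ) (x0 xg : Eucl n) (Δ₁ ε : ℝ) : ℝ := P.Bf γ₁ x0 xg Δ₁ * ε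

/-- `ε₃ = (2 D_z B_f + 2 D_z B_f²) ε`. -/
def tol₃ (γ₁ : ℝ) (x0 xg : Eucl n) (Δ₁ ε : ℝ) : ℝ :=
  (2 * P.Dz x0 xg Δ₁ * P.Bf γ₁ x0 xg Δ₁ + 2 * P.Dz x0 xg Δ₁ * P.Bf γ₁ x0 xg Δ₁ ^ 2) * ε

/-- The interval search for the value `c` with the prescribed tolerances. -/
def RunIntV (prm : APGParams) (x0 xg : Eucl n) (ε c Δ₁ σ : ℝ) (w : Eucl n)
    (a b : ℝ) (xb : Eucl n) : Prop :=
  IntV P prm x0 ε c (P.Dz x0 xg Δ₁) (tol₁ ε) (P.tol₂ prm.γ₁ x0 xg Δ₁ ε)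
    (P.tol₃ prm.γ₁ x0 xg Δ₁ ε) σ w a b xb

/-- The bisection for the value `c` with the prescribed tolerances and initial point `w`. -/
def RunBisec (prm : APGParams) (x0 xg : Eucl n) (ε c Δ₁ : ℝ) (a b : ℝ) (xb w : Eucl n)
    (xout : Eucl n) (zout : ℝ) (N : ℕ) : Prop :=
  Bisec P prm x0 ε c (tol₁ ε) (P.tol₂ prm.γ₁ x0 xg Δ₁ ε) (P.tol₃ prm.γ₁ x0 xg Δ₁ ε) (tol₁ ε)
    a b xb w xout zout N

/-- The multiplier intervals `Z = [a, b]` (with the point `xb` computed for `b`) on which the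
bisection is called for the value `c`: `Z` is returned by an interval search for `c`, or
`Z = [0, max Z']` where `Z'` was returned by an interval search for a smaller value `c'`. -/
def BisecInput (prm : APGParams) (x0 xg : Eucl n) (ε c Δ₁ : ℝ) (a b : ℝ) (xb : Eucl n) : Prop :=
  ∃ (σ : ℝ) (w : Eucl n), 0 < σ ∧ σ ≤ 2 * P.Dz x0 xg Δ₁ ∧ w ∈ P.levDL prm.γ₁ x0 xg Δ₁ ∧
    (P.RunIntV prm x0 xg ε c Δ₁ σ w a b xb ∨
      (a = 0 ∧ ∃ (c' a' : ℝ), c' ≤ c ∧ P.RegularCondition x0 xg ε c' Δ₁ ∧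
        P.RunIntV prm x0 xg ε c' Δ₁ σ w a' b xb))

end Bilevel

end

/-! ### Smooth and strongly convex functions -/

section Smooth

variable {E : Type*} [NormedAddCommGroup E] [InnerProductSpace ℝ E]

/-! For `0 ≤ z ≤ 2 D_z` the penalized function `g_ε + g₂ + z f` is ε-strongly convex, and its smooth
part has a gradient of Lipschitz constant at most `L_φ = L_{g₁} + 2 D_z L_{f₁} + 1`. The proof
bounds the cost of one inner call, locates its output, and compares outputs for nearby multipliers.

Cost of a call. The Lyapunov function `apgEnergy` shrinks by the factor `1 - α_k`, `α_k =
√(μ/L̃_k)`, in each iteration (`apgEnergy_step`), and the stopping test succeeds once it is below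
`stopLevel` (`APGSetting.nearStationary`). The line searches are paid for by amortization: as `log t
≤ 2 √t`, an iteration costs at most `√(M/μ)` times a combination of `α_k` and `√(μ/L_k)`, the latter
being at most `√γ₂ α_{k-1}` after the first iteration. Since the logarithm of the energy drops by at
least `α_k`, the sum telescopes to `O(√(M/μ) log(E₀/stopLevel))` (`APGSetting.loop_cost`). With `μ =
ε` and tolerance `ε²` the logarithm is at most `5 |log ε|` for small ε.

Location. Comparison with `x⁰` shows that every ε²-stationary point for `z ≤ 2 D_z` lies in
`Lev_g(D_{L_z})` (`nearOpt_mem_levDL`), so each call can be warm-started from the previous output,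
at distance at most `D` from the new minimizer. The regular condition at `x⁰` forces `z ≤ D_z` as
soon as the output is infeasible (`multiplier_le`); hence the interval search ends with a feasible
right endpoint.

Complementary slackness. When a bracket `[a, b]` is shorter than `ε²`, with an infeasible point at
`a` and a feasible one at `b`, strong convexity puts the two points at distance `O(ε)`, so `f_c` is
within `O(ε)` of zero at the feasible one; if `a = 0`, then `b` itself is at most `ε²`
(`abs_mul_fc_le`). Halving an interval of length at most `2 D_z` down to `ε²` takes `O(|log ε|)`
calls, which gives the second logarithm. -/

theorem nonpos_of_forall_le_mul {a b : ℝ} (h : ∀ t : ℝ, 0 < t → t < 1 → a ≤ t * b) : a ≤ 0 := by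
  by_contra! ha
  have hb : a ≤ 1 / 2 * b := h _ (by norm_num) (by norm_num)
  have hb0 : 0 < b := by linarith
  have h1 := h (a / (2 * b)) (by positivity) (by rw [div_lt_one (by positivity)]; linarith)
  have h2 : a / (2 * b) * b = a / 2 := by field_simp
  linarith

/-- A subgradient inequality for `q + h` with `h` convex and `q` strongly convex upgrades to one
with quadratic growth. -/
theorem strong_growth {S : Set E} {h : E → ℝ} (hh : ConvexOn ℝ S h) {q : E → ℝ} {G : E → E} {μ : ℝ}
    (hq : ∀ x y, q y + inner ℝ (G y) (x - y) + μ / 2 * ‖x - y‖ ^ 2 ≤ q x) {x v : E} (hx : x ∈ S)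
    (hv : ∀ u ∈ S, q x + h x + inner ℝ v (u - x) ≤ q u + h u) :
    ∀ u ∈ S, q x + h x + inner ℝ v (u - x) + μ / 2 * ‖u - x‖ ^ 2 ≤ q u + h u := by
  intro u hu
  suffices H : inner ℝ v (u - x) + q x + h x + μ / 2 * ‖u - x‖ ^ 2 - (q u + h u) ≤ 0 by linarith
  -- Compare `x` with a point a fraction `t` of the way to `u`: after division by `t` the quadratic
  -- term is lost only up to `O(t)`, which vanishes in the limit.
  refine nonpos_of_forall_le_mul (b := μ / 2 * ‖u - x‖ ^ 2) fun t ht0 ht1 => ?_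
  set y := (1 - t) • x + t • u with hy
  have hyS : y ∈ S := hh.1 hx hu (by linarith) ht0.le (by ring)
  have h1 : h y ≤ (1 - t) * h x + t * h u := by
    simpa using hh.2 hx hu (by linarith : (0 : ℝ) ≤ 1 - t) ht0.le (by ring)
  have h2 := hv y hyS
  have hyx : y - x = t • (u - x) := by rw [hy]; module
  have hxy : x - y = (-t) • (u - x) := by rw [hy]; module
  have huy : u - y = (1 - t) • (u - x) := by rw [hy]; module
  have h3 := hq x y
  have h4 := hq u y
  rw [hxy, inner_smul_right, norm_smul, mul_pow, Real.norm_eq_abs, sq_abs] at h3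
  rw [huy, inner_smul_right, norm_smul, mul_pow, Real.norm_eq_abs, sq_abs] at h4
  rw [hyx, inner_smul_right] at h2
  have h5 : q y + μ / 2 * (t * (1 - t) * ‖u - x‖ ^ 2) ≤ (1 - t) * q x + t * q u := by
    have := mul_le_mul_of_nonneg_left h3 (by linarith : (0 : ℝ) ≤ 1 - t)
    have := mul_le_mul_of_nonneg_left h4 ht0.le
    nlinarith
  have h6 : t * (inner ℝ v (u - x) + q x + h x + μ / 2 * ‖u - x‖ ^ 2 - (q u + h u))
      ≤ t * (t * (μ / 2 * ‖u - x‖ ^ 2)) := by nlinarith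
  exact le_of_mul_le_mul_left h6 ht0

theorem sq_norm_sub_lower (M : ℝ) (w x y : E) :
    M / 2 * ‖y - w‖ ^ 2 + inner ℝ (M • (y - w)) (x - y) + M / 2 * ‖x - y‖ ^ 2
      = M / 2 * ‖x - w‖ ^ 2 := by
  have h : x - w = (y - w) + (x - y) := by abel
  rw [h, norm_add_sq_real, inner_smul_left]
  simp only [conj_trivial]
  ring

variable [CompleteSpace E]

/-- `φ` is `μ`-strongly convex with an `L`-Lipschitz gradient. -/
structure SmoothStrong (φ : E → ℝ) (μ L : ℝ) : Prop where
  lower : ∀ x y, φ y + inner ℝ (gradient φ y) (x - y) + μ / 2 * ‖x - y‖ ^ 2 ≤ φ x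
  upper : ∀ x y, φ x ≤ φ y + inner ℝ (gradient φ y) (x - y) + L / 2 * ‖x - y‖ ^ 2
  lip : ∀ x y, ‖gradient φ x - gradient φ y‖ ≤ L * ‖x - y‖
  diff : Differentiable ℝ φ

theorem hasDerivAt_comp_segment {φ : E → ℝ} (hd : Differentiable ℝ φ) (y d : E) (t : ℝ) :
    HasDerivAt (fun s : ℝ => φ (y + s • d)) (inner ℝ (gradient φ (y + t • d)) d) t := by
  have h1 : HasDerivAt (fun s : ℝ => y + s • d) d t := by
    simpa using ((hasDerivAt_id t).smul_const d).const_add y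
  have h2 := (hd (y + t • d)).hasFDerivAt.comp_hasDerivAt t h1
  rw [inner_gradient_left]
  exact h2

theorem ConvexOn.gradient_le {φ : E → ℝ} (hc : ConvexOn ℝ Set.univ φ) (hd : Differentiable ℝ φ)
    (x y : E) : φ y + inner ℝ (gradient φ y) (x - y) ≤ φ x := by
  have hcc : ConvexOn ℝ Set.univ (fun s : ℝ => φ (y + s • (x - y))) := by
    refine ⟨convex_univ, fun a _ b _ p q hp hq hpq => ?_⟩
    have := hc.2 (Set.mem_univ (y + a • (x - y))) (Set.mem_univ (y + b • (x - y))) hp hq hpq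
    convert this using 2
    rw [← sub_eq_zero]
    have : q = 1 - p := by linarith
    subst this
    simp only [smul_eq_mul]
    module
  have h := hcc.le_slope_of_hasDerivAt (Set.mem_univ 0) (Set.mem_univ 1) zero_lt_one
    (hasDerivAt_comp_segment hd y (x - y) 0)
  simp [slope_def_field, -inner_gradient_left] at h
  linarith

theorem LipschitzWith.descent {φ : E → ℝ} {L : ℝ≥0} (hL : LipschitzWith L (gradient φ))
    (hd : Differentiable ℝ φ) (x y : E) :
    φ x ≤ φ y + inner ℝ (gradient φ y) (x - y) + L / 2 * ‖x - y‖ ^ 2 := by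
  set d := x - y with hdd
  -- The gap between `φ` and its quadratic model along the segment. Lipschitz continuity of the
  -- gradient makes its derivative nonpositive, so monotonicity replaces integration.
  let k : ℝ → ℝ := fun s => φ (y + s • d) - s * inner ℝ (gradient φ y) d - L / 2 * s ^ 2 * ‖d‖ ^ 2
  have hk : ∀ s, HasDerivAt k (inner ℝ (gradient φ (y + s • d)) d - inner ℝ (gradient φ y) d
      - L * s * ‖d‖ ^ 2) s := by
    intro s
    have h1 := hasDerivAt_comp_segment hd y d s
    have h2 : HasDerivAt (fun s : ℝ => s * inner ℝ (gradient φ y) d)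
        (inner ℝ (gradient φ y) d) s := by
      simpa using (hasDerivAt_id s).mul_const (inner ℝ (gradient φ y) d)
    have h3 : HasDerivAt (fun s : ℝ => L / 2 * s ^ 2 * ‖d‖ ^ 2) (L * s * ‖d‖ ^ 2) s := by
      have := (((hasDerivAt_id s).pow 2).const_mul ((L : ℝ) / 2)).mul_const (‖d‖ ^ 2)
      exact this.congr_deriv (by simp only [id_eq]; push_cast; ring)
    exact (h1.sub h2).sub h3
  have hanti : AntitoneOn k (Set.Icc 0 1) := by
    refine antitoneOn_of_deriv_nonpos (convex_Icc 0 1)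
      (fun s _ => (hk s).continuousAt.continuousWithinAt)
      (fun s _ => (hk s).differentiableAt.differentiableWithinAt) fun s hs => ?_
    rw [interior_Icc] at hs
    rw [(hk s).deriv, ← inner_sub_left]
    have h1 := real_inner_le_norm (gradient φ (y + s • d) - gradient φ y) d
    have h2 := hL.dist_le_mul (y + s • d) y
    rw [dist_eq_norm, dist_eq_norm, add_sub_cancel_left, norm_smul, Real.norm_eq_abs,
      abs_of_pos hs.1] at h2
    have h3 := mul_le_mul_of_nonneg_right h2 (norm_nonneg d)
    nlinarith
  have h := hanti (Set.left_mem_Icc.2 zero_le_one) (Set.right_mem_Icc.2 zero_le_one) zero_le_one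
  simp only [k, one_smul, zero_smul] at h
  have hx : y + d = x := by rw [hdd]; abel
  rw [hx, add_zero] at h
  linarith

theorem SmoothStrong.of_convex {φ : E → ℝ} {L : ℝ≥0} (hc : ConvexOn ℝ Set.univ φ)
    (hd : Differentiable ℝ φ) (hL : LipschitzWith L (gradient φ)) : SmoothStrong φ 0 L where
  lower x y := by simpa using hc.gradient_le hd x y
  upper x y := hL.descent hd x y
  lip x y := by simpa [dist_eq_norm] using hL.dist_le_mul x y
  diff := hd

theorem SmoothStrong.mono {φ : E → ℝ} {μ L L' : ℝ} (h : SmoothStrong φ μ L) (hL : L ≤ L') :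
    SmoothStrong φ μ L' where
  lower := h.lower
  upper x y := (h.upper x y).trans (by gcongr)
  lip x y := (h.lip x y).trans (by gcongr)
  diff := h.diff

theorem gradient_add_const_mul {φ ψ : E → ℝ} (hφ : Differentiable ℝ φ) (hψ : Differentiable ℝ ψ)
    (z : ℝ) (x : E) :
    gradient (fun x => φ x + z * ψ x) x = gradient φ x + z • gradient ψ x := by
  refine HasGradientAt.gradient ?_
  rw [hasGradientAt_iff_hasFDerivAt, map_add, map_smulₛₗ, toDual_gradient, toDual_gradient]
  exact (hφ x).hasFDerivAt.add ((hψ x).hasFDerivAt.const_mul z)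

theorem SmoothStrong.add_const_mul {φ ψ : E → ℝ} {μ ν L K z : ℝ} (h : SmoothStrong φ μ L)
    (k : SmoothStrong ψ ν K) (hz : 0 ≤ z) :
    SmoothStrong (fun x => φ x + z * ψ x) (μ + z * ν) (L + z * K) where
  lower x y := by
    rw [gradient_add_const_mul h.diff k.diff, inner_add_left, inner_smul_left]
    have h1 := h.lower x y
    have h2 := mul_le_mul_of_nonneg_left (k.lower x y) hz
    simp only [conj_trivial]
    nlinarith
  upper x y := by
    rw [gradient_add_const_mul h.diff k.diff, inner_add_left, inner_smul_left]
    have h1 := h.upper x y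
    have h2 := mul_le_mul_of_nonneg_left (k.upper x y) hz
    simp only [conj_trivial]
    nlinarith
  lip x y := by
    rw [gradient_add_const_mul h.diff k.diff, gradient_add_const_mul h.diff k.diff]
    calc _ = ‖(gradient φ x - gradient φ y) + z • (gradient ψ x - gradient ψ y)‖ := by
            congr 1; module
      _ ≤ L * ‖x - y‖ + z * (K * ‖x - y‖) := by
            refine (norm_add_le _ _).trans (add_le_add (h.lip x y) ?_)
            rw [norm_smul, Real.norm_of_nonneg hz]
            exact mul_le_mul_of_nonneg_left (k.lip x y) hz
      _ = _ := by ring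
  diff := h.diff.add (k.diff.const_mul z)

theorem smoothStrong_sq (w : E) : SmoothStrong (fun x => ‖x - w‖ ^ 2) 2 2 := by
  have hg : ∀ x, gradient (fun x => ‖x - w‖ ^ 2) x = (2 : ℝ) • (x - w) := by
    intro x
    refine HasGradientAt.gradient ?_
    rw [hasGradientAt_iff_hasFDerivAt]
    have h := ((hasFDerivAt_id (𝕜 := ℝ) x).sub_const w).norm_sq
    refine h.congr_fderiv ?_
    ext v
    simp [two_mul]
  have hid := sq_norm_sub_lower (2 : ℝ) w
  refine ⟨fun x y => ?_, fun x y => ?_, fun x y => ?_, ?_⟩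
  · rw [hg]; have := hid x y; norm_num at this ⊢; exact this.le
  · rw [hg]; have := hid x y; norm_num at this ⊢; exact this.ge
  · rw [hg, hg, ← smul_sub, norm_smul]; simp
  · exact (differentiable_id.sub_const w).norm_sq ℝ

end Smooth

/-! ### Extended-real-valued convex functions -/

section Convex

variable {n : ℕ} {φ : Eucl n → EReal}

theorem coe_toReal_of_mem_effDom (hb : ∀ x, φ x ≠ ⊥) {x : Eucl n} (hx : x ∈ effDom φ) :
    ((φ x).toReal : EReal) = φ x :=
  EReal.coe_toReal (ne_of_lt hx) (hb x)

theorem le_coe_iff (hb : ∀ x, φ x ≠ ⊥) {x : Eucl n} {r : ℝ} :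
    φ x ≤ (r : EReal) ↔ x ∈ effDom φ ∧ (φ x).toReal ≤ r := by
  constructor
  · intro h
    have hx : x ∈ effDom φ := lt_of_le_of_lt h (EReal.coe_lt_top r)
    refine ⟨hx, ?_⟩
    rw [← coe_toReal_of_mem_effDom hb hx] at h
    exact_mod_cast h
  · rintro ⟨hx, h⟩
    rw [← coe_toReal_of_mem_effDom hb hx]
    exact_mod_cast h

theorem eq_top_of_notMem_effDom {x : Eucl n} (hx : x ∉ effDom φ) : φ x = ⊤ :=
  not_lt_top_iff.1 hx

theorem ProperLscConvex.convexOn (h : ProperLscConvex φ) :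
    ConvexOn ℝ (effDom φ) (fun x => (φ x).toReal) := by
  have key : ∀ x ∈ effDom φ, ∀ y ∈ effDom φ, ∀ a b : ℝ, 0 ≤ a → 0 ≤ b → a + b = 1 →
      φ (a • x + b • y) ≤ ((a * (φ x).toReal + b * (φ y).toReal : ℝ) : EReal) := by
    intro x hx y hy a b ha hb hab
    have := h.convex_epi (x := (x, (φ x).toReal)) ((le_coe_iff h.ne_bot).2 ⟨hx, le_rfl⟩)
      (y := (y, (φ y).toReal)) ((le_coe_iff h.ne_bot).2 ⟨hy, le_rfl⟩) ha hb hab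
    simpa using this
  refine ⟨fun x hx y hy a b ha hb hab => ?_, fun x hx y hy a b ha hb hab => ?_⟩
  · exact ((le_coe_iff h.ne_bot).1 (key x hx y hy a b ha hb hab)).1
  · simpa using ((le_coe_iff h.ne_bot).1 (key x hx y hy a b ha hb hab)).2

theorem convex_epi_of_convexOn (hb : ∀ x, φ x ≠ ⊥)
    (h : ConvexOn ℝ (effDom φ) (fun x => (φ x).toReal)) :
    Convex ℝ {p : Eucl n × ℝ | φ p.1 ≤ (p.2 : EReal)} := by
  have := h.convex_epigraph
  convert this using 3
  exact le_coe_iff hb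

theorem ProperLscConvex.exists_mem (h : ProperLscConvex φ) : ∃ x, x ∈ effDom φ := by
  obtain ⟨x, hx⟩ := h.exists_ne_top
  exact ⟨x, lt_top_iff_ne_top.2 hx⟩

/-- A proper lower semicontinuous convex function is bounded below by a multiple of the norm. -/
theorem ProperLscConvex.exists_linear_bound (h : ProperLscConvex φ) :
    ∃ A B : ℝ, 0 ≤ A ∧ ∀ u ∈ effDom φ, -(A * ‖u‖) - B ≤ (φ u).toReal := by
  obtain ⟨x, hx⟩ := h.exists_mem
  have hcl : IsClosed {p : Eucl n × ℝ | φ p.1 ≤ (p.2 : EReal)} := by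
    have := h.lsc.isClosed_epigraph
    exact this.preimage (f := fun p : Eucl n × ℝ => (p.1, (p.2 : EReal)))
      (continuous_fst.prodMk (continuous_coe_real_ereal.comp continuous_snd))
  -- Separate a point just below the graph from the closed epigraph. It lies vertically under a
  -- point of the epigraph, so the separating functional has positive vertical coefficient, and
  -- dividing by it gives an affine minorant.
  have hnot : (x, (φ x).toReal - 1) ∉ {p : Eucl n × ℝ | φ p.1 ≤ (p.2 : EReal)} := by
    intro hmem
    have := ((le_coe_iff h.ne_bot).1 hmem).2
    simp only at this
    linarith
  obtain ⟨F, s, hs1, hs2⟩ := geometric_hahn_banach_point_closed h.convex_epi hcl hnot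
  have hF : ∀ (u : Eucl n) (r : ℝ), F (u, r) = F (u, 0) + r * F (0, 1) := by
    intro u r
    have : (u, r) = (u, (0 : ℝ)) + r • ((0 : Eucl n), (1 : ℝ)) := by simp
    rw [this, map_add, map_smul, smul_eq_mul]
  have hmem : ∀ u ∈ effDom φ, s < F (u, 0) + (φ u).toReal * F (0, 1) := by
    intro u hu
    rw [← hF]
    exact hs2 _ ((le_coe_iff h.ne_bot).2 ⟨hu, le_rfl⟩)
  have hκ : 0 < F (0, 1) := by
    have h1 := hmem x hx
    rw [hF] at hs1
    linarith
  refine ⟨‖F‖ / F (0, 1), -(s / F (0, 1)), by positivity, fun u hu => ?_⟩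
  have h1 := hmem u hu
  have h2 : F (u, 0) ≤ ‖F‖ * ‖u‖ := by
    have := F.le_opNorm (u, 0)
    rw [Prod.norm_mk, norm_zero, max_eq_left (norm_nonneg u)] at this
    exact (le_abs_self _).trans this
  have h3 : -(‖F‖ / F (0, 1) * ‖u‖) - -(s / F (0, 1)) = (s - ‖F‖ * ‖u‖) / F (0, 1) := by
    field_simp; ring
  rw [h3, div_le_iff₀ hκ]
  linarith

/-- The sum of a proper lower semicontinuous convex function and a coercive continuous function
attains its minimum. -/
theorem ProperLscConvex.exists_min (h : ProperLscConvex φ) {q : Eucl n → ℝ} (hq : Continuous q)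
    {a b c : ℝ} (ha : 0 < a) (hqc : ∀ u, a * ‖u‖ ^ 2 - b * ‖u‖ - c ≤ q u) :
    ∃ x ∈ effDom φ, ∀ u ∈ effDom φ, q x + (φ x).toReal ≤ q u + (φ u).toReal := by
  obtain ⟨A, B, hA, hAB⟩ := h.exists_linear_bound
  obtain ⟨w, hw⟩ := h.exists_mem
  set V := q w + (φ w).toReal with hV
  -- Beyond `R` the quadratic growth of `q` beats the linear minorant of `φ` and exceeds the value
  -- `V` at `w`, so the minimum over the compact ball is global.
  obtain ⟨R, hR0, hR⟩ : ∃ R : ℝ, ‖w‖ ≤ R ∧ ∀ r, R < r → V < a * r ^ 2 - (b + A) * r - (c + B) := by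
    refine ⟨max (‖w‖) ((|b + A| + |c + B + V| + 1) / a + 1), le_max_left _ _, fun r hr => ?_⟩
    have h1 : (|b + A| + |c + B + V| + 1) / a + 1 < r := (le_max_right _ _).trans_lt hr
    have h2 : |b + A| + |c + B + V| + 1 < (r - 1) * a := by
      rw [← div_lt_iff₀ ha]; linarith
    have h0 : 0 ≤ (|b + A| + |c + B + V| + 1) / a := by positivity
    have hr1 : 1 < r := by linarith
    have h3 := le_abs_self (b + A)
    have h4 := le_abs_self (c + B + V)
    have h5 : |b + A| + |c + B + V| + 1 < r * a := by nlinarith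
    have h6 : (|b + A| + |c + B + V| + 1) * r ≤ r * a * r :=
      mul_le_mul_of_nonneg_right h5.le (by linarith)
    have h7 : (b + A) * r ≤ |b + A| * r := mul_le_mul_of_nonneg_right h3 (by linarith)
    have h8 : |c + B + V| ≤ |c + B + V| * r := le_mul_of_one_le_right (abs_nonneg _) hr1.le
    nlinarith
  have hlsc : LowerSemicontinuous (fun u => (q u : EReal) + φ u) := by
    refine LowerSemicontinuous.add' ?_ h.lsc fun u => ?_
    · exact (continuous_coe_real_ereal.comp hq).lowerSemicontinuous
    · exact EReal.continuousAt_add (Or.inl (EReal.coe_ne_top _)) (Or.inl (EReal.coe_ne_bot _))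
  obtain ⟨x, hxR, hx⟩ := (hlsc.lowerSemicontinuousOn (Metric.closedBall 0 R)).exists_isMinOn
    ⟨w, by simpa using hR0⟩ (isCompact_closedBall 0 R)
  have hreal : ∀ u ∈ effDom φ, (q u : EReal) + φ u = ((q u + (φ u).toReal : ℝ) : EReal) := by
    intro u hu
    rw [EReal.coe_add, coe_toReal_of_mem_effDom h.ne_bot hu]
  have hxw : (q x : EReal) + φ x ≤ (q w : EReal) + φ w := hx (by simpa using hR0)
  have hxd : x ∈ effDom φ := by
    by_contra hcon
    rw [eq_top_of_notMem_effDom hcon, EReal.coe_add_top, hreal w hw] at hxw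
    exact absurd hxw (not_le.2 (EReal.coe_lt_top _))
  have hxw' : q x + (φ x).toReal ≤ V := by
    rw [hreal w hw, hreal x hxd] at hxw
    exact_mod_cast hxw
  refine ⟨x, hxd, fun u hu => ?_⟩
  by_cases huR : ‖u‖ ≤ R
  · have hxu : (q x : EReal) + φ x ≤ (q u : EReal) + φ u := hx (by simpa using huR)
    rw [hreal u hu, hreal x hxd] at hxu
    exact_mod_cast hxu
  · have h1 := hR _ (not_le.1 huR)
    have h2 := hqc u
    have h3 := hAB u hu
    nlinarith

theorem isProx_iff (h : ProperLscConvex φ) {t : ℝ} {y x : Eucl n} :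
    IsProx t φ y x ↔ x ∈ effDom φ ∧ ∀ u ∈ effDom φ,
      (φ x).toReal + 1 / (2 * t) * ‖x - y‖ ^ 2 ≤ (φ u).toReal + 1 / (2 * t) * ‖u - y‖ ^ 2 := by
  have hreal : ∀ u ∈ effDom φ, φ u + ((1 / (2 * t) * ‖u - y‖ ^ 2 : ℝ) : EReal)
      = (((φ u).toReal + 1 / (2 * t) * ‖u - y‖ ^ 2 : ℝ) : EReal) := by
    intro u hu
    rw [EReal.coe_add, coe_toReal_of_mem_effDom h.ne_bot hu]
  constructor
  · intro hx
    have hle : ∀ u, φ x + ((1 / (2 * t) * ‖x - y‖ ^ 2 : ℝ) : EReal)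
        ≤ φ u + ((1 / (2 * t) * ‖u - y‖ ^ 2 : ℝ) : EReal) := fun u => hx (Set.mem_univ u)
    have hxd : x ∈ effDom φ := by
      obtain ⟨w, hw⟩ := h.exists_mem
      by_contra hcon
      have := hle w
      rw [eq_top_of_notMem_effDom hcon, EReal.top_add_coe, hreal w hw] at this
      exact absurd this (not_le.2 (EReal.coe_lt_top _))
    refine ⟨hxd, fun u hu => ?_⟩
    have := hle u
    rw [hreal x hxd, hreal u hu] at this
    exact_mod_cast this
  · rintro ⟨hxd, hx⟩ u -
    by_cases hu : u ∈ effDom φ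
    · change φ x + _ ≤ φ u + _
      rw [hreal x hxd, hreal u hu]
      exact_mod_cast hx u hu
    · change φ x + _ ≤ φ u + _
      rw [eq_top_of_notMem_effDom hu, EReal.top_add_coe]
      exact le_top

theorem exists_isProx (h : ProperLscConvex φ) {t : ℝ} (ht : 0 < t) (y : Eucl n) :
    ∃ x, IsProx t φ y x := by
  have hq : Continuous (fun u : Eucl n => 1 / (2 * t) * ‖u - y‖ ^ 2) := by fun_prop
  obtain ⟨x, hx, hmin⟩ := h.exists_min hq (a := 1 / (2 * t)) (b := 1 / t * ‖y‖) (c := 0)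
    (by positivity) fun u => by
      have h1 : 1 / (2 * t) * (‖u‖ ^ 2 - 2 * (‖u‖ * ‖y‖)) ≤ 1 / (2 * t) * ‖u - y‖ ^ 2 := by
        refine mul_le_mul_of_nonneg_left ?_ (by positivity)
        rw [norm_sub_sq_real]
        have := real_inner_le_norm u y
        nlinarith [sq_nonneg ‖y‖]
      refine le_trans (le_of_eq ?_) h1
      field_simp
      ring
  exact ⟨x, (isProx_iff h).2 ⟨hx, fun u hu => by linarith [hmin u hu]⟩⟩

variable {φ₁ : Eucl n → ℝ}

theorem mem_subdiff_add_iff (h : ProperLscConvex φ) {x v : Eucl n} :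
    v ∈ subdiff (fun u => (φ₁ u : EReal) + φ u) x ↔ x ∈ effDom φ ∧ ∀ u ∈ effDom φ,
      φ₁ x + (φ x).toReal + inner ℝ v (u - x) ≤ φ₁ u + (φ u).toReal := by
  have hreal : ∀ u ∈ effDom φ, (φ₁ u : EReal) + φ u = ((φ₁ u + (φ u).toReal : ℝ) : EReal) := by
    intro u hu
    rw [EReal.coe_add, coe_toReal_of_mem_effDom h.ne_bot hu]
  constructor
  · intro hx
    have hxd : x ∈ effDom φ := by
      obtain ⟨w, hw⟩ := h.exists_mem
      by_contra hcon
      have := hx w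
      simp only at this
      rw [eq_top_of_notMem_effDom hcon, EReal.coe_add_top, EReal.top_add_coe, hreal w hw] at this
      exact absurd this (not_le.2 (EReal.coe_lt_top _))
    refine ⟨hxd, fun u hu => ?_⟩
    have := hx u
    simp only at this
    rw [hreal x hxd, hreal u hu] at this
    exact_mod_cast this
  · rintro ⟨hxd, hx⟩ u
    simp only
    by_cases hu : u ∈ effDom φ
    · rw [hreal x hxd, hreal u hu]
      exact_mod_cast hx u hu
    · rw [eq_top_of_notMem_effDom hu, EReal.coe_add_top]
      exact le_top

theorem nearStationary_of_mem {ψ : Eucl n → EReal} {x v : Eucl n} {δ : ℝ} (hv : v ∈ subdiff ψ x)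
    (hδ : ‖v‖ ≤ δ) : NearStationary ψ δ x := by
  refine (Metric.infEDist_le_edist_of_mem hv).trans ?_
  rw [edist_dist, dist_zero_left]
  exact ENNReal.ofReal_le_ofReal hδ

theorem NearStationary.mono {ψ : Eucl n → EReal} {x : Eucl n} {δ δ' : ℝ}
    (h : NearStationary ψ δ x) (hδ : δ ≤ δ') : NearStationary ψ δ' x :=
  le_trans h (ENNReal.ofReal_le_ofReal hδ)

/-- The infimal distance need not be known to be attained, hence the slack `η > δ`;
`NearStationary.growth` removes it by a limit. -/
theorem NearStationary.exists_mem {ψ : Eucl n → EReal} {x : Eucl n} {δ η : ℝ}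
    (h : NearStationary ψ δ x) (hδ : 0 ≤ δ) (hη : δ < η) : ∃ v ∈ subdiff ψ x, ‖v‖ < η := by
  have h1 : Metric.infEDist 0 (subdiff ψ x) < ENNReal.ofReal η :=
    h.trans_lt ((ENNReal.ofReal_lt_ofReal_iff (hδ.trans_lt hη)).2 hη)
  obtain ⟨v, hv, hd⟩ := Metric.infEDist_lt_iff.1 h1
  refine ⟨v, hv, ?_⟩
  rw [edist_dist, dist_zero_left] at hd
  exact (ENNReal.ofReal_lt_ofReal_iff (hδ.trans_lt hη)).1 hd

theorem NearStationary.mem_effDom (h : ProperLscConvex φ) {x : Eucl n} {δ : ℝ} (hδ : 0 ≤ δ)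
    (hs : NearStationary (fun u => (φ₁ u : EReal) + φ u) δ x) : x ∈ effDom φ := by
  obtain ⟨v, hv, -⟩ := hs.exists_mem hδ (lt_add_one δ)
  exact ((mem_subdiff_add_iff h).1 hv).1

/-- A subgradient of norm close to `δ` contributes at least `-δ ‖u - x‖` by Cauchy–Schwarz, and
`strong_growth` adds the quadratic term. All comparisons between near-optimal points rest on this.
-/
theorem NearStationary.growth (h : ProperLscConvex φ) {μ L : ℝ} (hφ₁ : SmoothStrong φ₁ μ L)
    {x : Eucl n} {δ : ℝ} (hδ : 0 ≤ δ) (hs : NearStationary (fun u => (φ₁ u : EReal) + φ u) δ x)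
    {u : Eucl n} (hu : u ∈ effDom φ) :
    φ₁ x + (φ x).toReal - δ * ‖u - x‖ + μ / 2 * ‖u - x‖ ^ 2 ≤ φ₁ u + (φ u).toReal := by
  suffices H : ∀ η, δ < η →
      φ₁ x + (φ x).toReal - η * ‖u - x‖ + μ / 2 * ‖u - x‖ ^ 2 ≤ φ₁ u + (φ u).toReal by
    suffices H2 : φ₁ x + (φ x).toReal - δ * ‖u - x‖ + μ / 2 * ‖u - x‖ ^ 2
        - (φ₁ u + (φ u).toReal) ≤ 0 by linarith
    refine nonpos_of_forall_le_mul (b := ‖u - x‖) fun t ht _ => ?_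
    linarith [H (δ + t) (by linarith)]
  intro η hη
  obtain ⟨v, hv, hvη⟩ := hs.exists_mem hδ hη
  obtain ⟨hx, hsub⟩ := (mem_subdiff_add_iff h).1 hv
  have h1 := strong_growth h.convexOn hφ₁.lower hx hsub u hu
  have h2 := abs_le.1 (abs_real_inner_le_norm v (u - x))
  have h3 := mul_le_mul_of_nonneg_right hvη.le (norm_nonneg (u - x))
  linarith [h2.1]

/-- A smooth strongly convex function plus a proper lower semicontinuous convex function has a
minimizer. -/
theorem exists_minimizer (h : ProperLscConvex φ) {μ L : ℝ} (hμ : 0 < μ)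
    (hφ₁ : SmoothStrong φ₁ μ L) :
    ∃ x ∈ effDom φ, ∀ u ∈ effDom φ, φ₁ x + (φ x).toReal ≤ φ₁ u + (φ u).toReal := by
  refine h.exists_min hφ₁.diff.continuous (a := μ / 2) (b := ‖gradient φ₁ 0‖) (c := -φ₁ 0)
    (by positivity) fun u => ?_
  have h1 := hφ₁.lower u 0
  have h2 := abs_le.1 (abs_real_inner_le_norm (gradient φ₁ 0) u)
  rw [sub_zero] at h1
  linarith [h2.1]

end Convex

/-! ### One step of the accelerated proximal gradient method -/

noncomputable section APG

variable {n : ℕ} {φ₁ : Eucl n → ℝ} {φ₂ : Eucl n → EReal}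

/-- The objective `φ₁ + φ₂` as a real-valued function, meaningful on `dom φ₂`. -/
def realSum (φ₁ : Eucl n → ℝ) (φ₂ : Eucl n → EReal) (x : Eucl n) : ℝ := φ₁ x + (φ₂ x).toReal

/-- The optimality condition of the proximal step. Quadratic growth around the minimizer, once the
squares are expanded, is exactly this subgradient inequality, so no sum rule for subdifferentials is
needed. -/
theorem IsProxStep.variational (h : ProperLscConvex φ₂) {M : ℝ} (hM : 0 < M) {y x : Eucl n}
    (hx : IsProxStep φ₁ φ₂ M y x) : x ∈ effDom φ₂ ∧ ∀ u ∈ effDom φ₂,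
      (φ₂ x).toReal + inner ℝ (M • (y - x) - gradient φ₁ y) (u - x) ≤ (φ₂ u).toReal := by
  obtain ⟨hxd, hmin⟩ := (isProx_iff h).1 hx
  refine ⟨hxd, fun u hu => ?_⟩
  set g := gradient φ₁ y
  set w := y - (1 / M) • g with hw
  have hM2 : 1 / (2 * (1 / M)) = M / 2 := by field_simp
  rw [hM2] at hmin
  have h1 := strong_growth h.convexOn (q := fun x => M / 2 * ‖x - w‖ ^ 2)
    (G := fun y => M • (y - w)) (μ := M) (v := 0) (fun a b => (sq_norm_sub_lower M w a b).le) hxd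
    (fun u hu => by simpa [add_comm] using hmin u hu) u hu
  have h2 := sq_norm_sub_lower M w u x
  have h3 : M • (y - x) - g = -(M • (x - w)) := by
    rw [hw, smul_sub, smul_sub, smul_sub, smul_smul]
    field_simp
    module
  rw [h3, inner_neg_left]
  simp only [inner_zero_left] at h1
  linarith

/-- Sum of three inequalities: the optimality condition for `φ₂`, strong convexity of `φ₁` at `y`,
and the acceptance test. -/
theorem prox_step_le (h : ProperLscConvex φ₂) {μ L : ℝ} (hs : SmoothStrong φ₁ μ L) {M : ℝ}
    (hM : 0 < M) {y x : Eucl n} (hx : IsProxStep φ₁ φ₂ M y x) (ht : DescentTest φ₁ M y x)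
    {u : Eucl n} (hu : u ∈ effDom φ₂) :
    realSum φ₁ φ₂ x + M * inner ℝ (y - x) (u - y) + M / 2 * ‖y - x‖ ^ 2 + μ / 2 * ‖u - y‖ ^ 2
      ≤ realSum φ₁ φ₂ u := by
  have h1 := (hx.variational h hM).2 u hu
  have h2 := hs.lower u y
  unfold DescentTest at ht
  have e1 : u - x = (u - y) + (y - x) := by abel
  have e2 : x - y = -(y - x) := by abel
  rw [e1, inner_sub_left, inner_smul_left, inner_add_right, inner_add_right,
    real_inner_self_eq_norm_sq, conj_trivial] at h1
  rw [e2, inner_neg_right, norm_neg] at ht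
  unfold realSum
  linarith

/-- Adding `∇φ₁(x)` to the subgradient of `φ₂` produced by the step gives an explicit element of
`∂(φ₁ + φ₂)(x)`, small when the step is short. -/
theorem nearStationary_of_prox_step (h : ProperLscConvex φ₂) {μ L : ℝ} (hμ : 0 ≤ μ)
    (hs : SmoothStrong φ₁ μ L) {M : ℝ} (hM : 0 < M) {y x : Eucl n}
    (hx : IsProxStep φ₁ φ₂ M y x) {δ : ℝ} (hδ : (M + L) * ‖y - x‖ ≤ δ) :
    NearStationary (fun u => (φ₁ u : EReal) + φ₂ u) δ x := by
  obtain ⟨hxd, hv⟩ := hx.variational h hM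
  refine nearStationary_of_mem (v := M • (y - x) - gradient φ₁ y + gradient φ₁ x)
    ((mem_subdiff_add_iff h).2 ⟨hxd, fun u hu => ?_⟩) (le_trans ?_ hδ)
  · have h1 := hv u hu
    have h2 := hs.lower u x
    have h3 : 0 ≤ μ / 2 * ‖u - x‖ ^ 2 := by positivity
    rw [inner_add_left]
    linarith
  · have e : M • (y - x) - gradient φ₁ y + gradient φ₁ x
        = M • (y - x) - (gradient φ₁ y - gradient φ₁ x) := by abel
    rw [e]
    refine (norm_sub_le _ _).trans ?_
    rw [norm_smul, Real.norm_of_nonneg hM.le]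
    linarith [hs.lip y x]

theorem sq_norm_combo_le {E : Type*} [NormedAddCommGroup E] [InnerProductSpace ℝ E] {t : ℝ}
    (h0 : 0 ≤ t) (h1 : t ≤ 1) (a b : E) :
    ‖(1 - t) • a + t • b‖ ^ 2 ≤ (1 - t) * ‖a‖ ^ 2 + t * ‖b‖ ^ 2 := by
  rw [norm_add_sq_real, norm_smul, norm_smul, inner_smul_left, inner_smul_right, mul_pow, mul_pow,
    Real.norm_eq_abs, Real.norm_eq_abs, sq_abs, sq_abs, conj_trivial]
  have h2 : 0 ≤ ‖a - b‖ ^ 2 := by positivity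
  rw [norm_sub_sq_real] at h2
  have h3 := mul_nonneg (mul_nonneg h0 (by linarith : (0 : ℝ) ≤ 1 - t)) h2
  nlinarith

/-- The Lyapunov function of the method at the state `(x_{k-1}, x_k, α_{k-1})`. -/
def apgEnergy (φ₁ : Eucl n → ℝ) (φ₂ : Eucl n → EReal) (μ : ℝ) (xs xprev x : Eucl n) (αprev : ℝ) :
    ℝ :=
  realSum φ₁ φ₂ x - realSum φ₁ φ₂ xs + μ / 2 * ‖xprev + (1 / αprev) • (x - xprev) - xs‖ ^ 2

/-- Weight `prox_step_le` at `x` by `1 - α` and at `xs` by `α`, and add. The new auxiliary point is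
`(1 - α) v + α y + (1/α)(x' - y)`; because `α² M = μ`, expanding its squared distance to `xs`
reproduces the inner product and the square in that sum. Only the current `M` enters, so trial
values need not be monotone. -/
theorem apgEnergy_step (h : ProperLscConvex φ₂) {μ L : ℝ} (hs : SmoothStrong φ₁ μ L) {M : ℝ}
    (hM : 0 < M) (hμ : 0 < μ) (hμM : μ ≤ M) {xs xprev x x' : Eucl n} {αprev : ℝ}
    (hα : 0 < αprev) (hxd : x ∈ effDom φ₂) (hxs : xs ∈ effDom φ₂)
    (hx : IsProxStep φ₁ φ₂ M (extrapolate μ xprev x αprev M) x')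
    (ht : DescentTest φ₁ M (extrapolate μ xprev x αprev M) x') :
    apgEnergy φ₁ φ₂ μ xs x x' √(μ / M)
      ≤ (1 - √(μ / M)) * apgEnergy φ₁ φ₂ μ xs xprev x αprev := by
  set y := extrapolate μ xprev x αprev M with hy
  set α := √(μ / M) with hαdef
  have hα0 : 0 < α := Real.sqrt_pos.2 (by positivity)
  have hαsq : α ^ 2 * M = μ := by
    rw [hαdef, Real.sq_sqrt (by positivity)]; field_simp
  have hα1 : α ≤ 1 := by
    rw [hαdef, ← Real.sqrt_one]; exact Real.sqrt_le_sqrt ((div_le_one hM).2 hμM)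
  set v := xprev + (1 / αprev) • (x - xprev) with hv
  -- The extrapolation coefficient is the one that makes `y` the weighted mean of `x` and the
  -- auxiliary point `v`.
  have hyv : (1 + α) • y = x + α • v := by
    rw [hy, hv, extrapolate, ← hαdef]
    have e : (1 + α) * (α * (1 - αprev) / (αprev * (1 + α))) = α * (1 / αprev - 1) := by
      field_simp
    rw [smul_add, smul_smul, e]
    module
  have hxe : x = (1 + α) • y - α • v := by rw [hyv]; abel
  set w := (1 - α) • v + α • y with hw
  have hv' : x + (1 / α) • (x' - x) - xs = (w - xs) + (1 / α) • (x' - y) := by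
    have e1 : (1 / α) • x' = (1 / α) • y + (1 / α) • (x' - y) := by rw [smul_sub]; abel
    have e2 : (1 / α) • x = (1 / α) • y + y - v := by
      rw [hxe, smul_sub, smul_smul, smul_smul]
      have a1 : 1 / α * (1 + α) = 1 / α + 1 := by field_simp
      have a2 : 1 / α * α = 1 := by field_simp
      rw [a1, a2]
      module
    rw [smul_sub, e1, e2, hw, hxe]
    module
  have hcomb : (1 - α) • (x - y) + α • (xs - y) = -(α • (w - xs)) := by
    rw [hw, hxe]; module
  have i1 := prox_step_le h hs hM hx ht hxd
  have i2 := prox_step_le h hs hM hx ht hxs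
  have hinner : (1 - α) * inner ℝ (y - x') (x - y) + α * inner ℝ (y - x') (xs - y)
      = α * inner ℝ (w - xs) (x' - y) := by
    rw [← inner_smul_right, ← inner_smul_right, ← inner_add_right, hcomb, ← neg_sub x' y,
      inner_neg_neg, inner_smul_right, real_inner_comm]
  have hw2 : ‖w - xs‖ ^ 2 ≤ (1 - α) * ‖v - xs‖ ^ 2 + α * ‖xs - y‖ ^ 2 := by
    have e : w - xs = (1 - α) • (v - xs) + α • (y - xs) := by rw [hw]; module
    rw [e, norm_sub_rev xs y]
    exact sq_norm_combo_le hα0.le hα1 _ _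
  have hexp : μ / 2 * ‖x + (1 / α) • (x' - x) - xs‖ ^ 2
      = μ / 2 * ‖w - xs‖ ^ 2 + α * M * inner ℝ (w - xs) (x' - y) + M / 2 * ‖y - x'‖ ^ 2 := by
    rw [hv', norm_add_sq_real, inner_smul_right, norm_smul, mul_pow, Real.norm_eq_abs, sq_abs,
      norm_sub_rev y x', ← hαsq]
    field_simp
  unfold apgEnergy
  rw [← hv, hexp]
  have j1 := mul_le_mul_of_nonneg_left i1 (by linarith : (0 : ℝ) ≤ 1 - α)
  have j2 := mul_le_mul_of_nonneg_left i2 hα0.le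
  have j3 : 0 ≤ (1 - α) * (μ / 2 * ‖x - y‖ ^ 2) :=
    mul_nonneg (by linarith) (by positivity)
  have j4 := mul_le_mul_of_nonneg_left hw2 (by positivity : 0 ≤ μ / 2)
  have j5 : M * ((1 - α) * inner ℝ (y - x') (x - y) + α * inner ℝ (y - x') (xs - y))
      = M * (α * inner ℝ (w - xs) (x' - y)) := by rw [hinner]
  linarith

/-- With `α = 1` the auxiliary point is `x` itself, and `μ ≤ M` lets the distance term be absorbed
by `prox_step_le` at `xs`. -/
theorem apgEnergy_init (h : ProperLscConvex φ₂) {μ L : ℝ} (hs : SmoothStrong φ₁ μ L) {M : ℝ}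
    (hM : 0 < M) (hμM : μ ≤ M) (hμ : 0 ≤ μ) {xs y x : Eucl n} (hxs : xs ∈ effDom φ₂)
    (hx : IsProxStep φ₁ φ₂ M y x) (ht : DescentTest φ₁ M y x) :
    apgEnergy φ₁ φ₂ μ xs x x 1 ≤ M / 2 * ‖xs - y‖ ^ 2 := by
  have i1 := prox_step_le h hs hM hx ht hxs
  have e : x - xs = -((xs - y) + (y - x)) := by abel
  have e2 : x + (1 / (1 : ℝ)) • (x - x) - xs = x - xs := by simp
  unfold apgEnergy
  have i2 : ‖x - xs‖ ^ 2 = ‖xs - y‖ ^ 2 + 2 * inner ℝ (y - x) (xs - y) + ‖y - x‖ ^ 2 := by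
    rw [e, norm_neg, norm_add_sq_real, real_inner_comm]
  have i3 : μ / 2 * ‖x - xs‖ ^ 2 ≤ M / 2 * ‖x - xs‖ ^ 2 := by gcongr
  have i4 : M / 2 * ‖x - xs‖ ^ 2
      = M / 2 * (‖xs - y‖ ^ 2 + 2 * inner ℝ (y - x) (xs - y) + ‖y - x‖ ^ 2) := by rw [i2]
  have i5 : 0 ≤ μ / 2 * ‖xs - y‖ ^ 2 := by positivity
  rw [e2]
  linarith

/-! ### Line searches -/

/-- The test holds automatically once the trial value reaches `L`, so finitely many multiplications
by `γ₁` suffice, even though the base point moves with the trial value. -/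
theorem LineSearch.exists_run (h : ProperLscConvex φ₂) {μ L : ℝ} (hs : SmoothStrong φ₁ μ L)
    {γ₁ : ℝ} (hγ : 1 < γ₁) (y : ℝ → Eucl n) {T : ℝ} (hT : 0 < T) :
    ∃ L' x' m, LineSearch φ₁ φ₂ γ₁ y T L' x' m := by
  obtain ⟨j, hj⟩ := pow_unbounded_of_one_lt (L / T) hγ
  have hj' : L ≤ γ₁ ^ j * T := ((div_lt_iff₀ hT).1 hj).le
  clear hj
  induction j generalizing T with
  | zero =>
    obtain ⟨x, hx⟩ := exists_isProx h (t := 1 / T) (by positivity)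
      (y T - (1 / T) • gradient φ₁ (y T))
    exact ⟨T, x, 1, .accept T x hx ((hs.mono (by simpa using hj')).upper x (y T))⟩
  | succ j ih =>
    obtain ⟨x, hx⟩ := exists_isProx h (t := 1 / T) (by positivity)
      (y T - (1 / T) • gradient φ₁ (y T))
    by_cases ht : DescentTest φ₁ T (y T) x
    · exact ⟨T, x, 1, .accept T x hx ht⟩
    · obtain ⟨L', x', m, hrun⟩ := ih (T := γ₁ * T) (by positivity)
        (hj'.trans_eq (by ring))
      exact ⟨L', x', m + 1, .reject T x L' x' m hx ht hrun⟩

/-- A rejected value is below `L`, so its successor is below `γ₁ L ≤ M`; each rejection adds exactly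
`log γ₁` to the logarithm of the trial value. -/
theorem LineSearch.bounds {μ L : ℝ} (hs : SmoothStrong φ₁ μ L) {γ₁ : ℝ} (hγ : 1 < γ₁)
    {y : ℝ → Eucl n} {M : ℝ} (hM : γ₁ * L ≤ M) {T L' : ℝ} {x' : Eucl n} {m : ℕ}
    (hrun : LineSearch φ₁ φ₂ γ₁ y T L' x' m) (hT : 0 < T) (hTM : T ≤ M) :
    T ≤ L' ∧ L' ≤ M ∧ IsProxStep φ₁ φ₂ L' (y L') x' ∧ DescentTest φ₁ L' (y L') x' ∧
      (m : ℝ) ≤ 1 + Real.log (L' / T) / Real.log γ₁ := by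
  induction hrun with
  | accept T x hx ht =>
    refine ⟨le_rfl, hTM, hx, ht, ?_⟩
    rw [div_self hT.ne']
    simp
  | reject T x L' x' m hx ht hrest ih =>
    have hTL : T < L := by
      by_contra! hcon
      exact ht ((hs.mono hcon).upper x (y T))
    have hγT : γ₁ * T ≤ M := le_trans (by gcongr) hM
    obtain ⟨h1, h2, h3, h4, h5⟩ := ih (by positivity) hγT
    have hT' : T ≤ γ₁ * T := le_mul_of_one_le_left hT.le hγ.le
    refine ⟨hT'.trans h1, h2, h3, h4, ?_⟩
    have hL' : 0 < L' := hT.trans_le (hT'.trans h1)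
    have hlog : 0 < Real.log γ₁ := Real.log_pos hγ
    rw [Real.log_div hL'.ne' (by positivity), Real.log_mul (by positivity) hT.ne'] at h5
    rw [Real.log_div hL'.ne' hT.ne']
    have e : (Real.log L' - (Real.log γ₁ + Real.log T)) / Real.log γ₁
        = (Real.log L' - Real.log T) / Real.log γ₁ - 1 := by field_simp; ring
    rw [e] at h5
    push_cast
    linarith

/-- Crude on purpose: a square root factors as `√(M/μ) √(μ/T)`, and the second factor is comparable
to the decrease of the log-energy. -/
theorem log_le_two_mul_sqrt {t : ℝ} (ht : 0 < t) : Real.log t ≤ 2 * √t := by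
  have h1 := Real.log_le_sub_one_of_pos (Real.sqrt_pos.2 ht)
  rw [Real.log_sqrt ht.le] at h1
  linarith

/-- The number of passes of a line search, in terms of the initial trial value. -/
theorem LineSearch.passes_le {μ L : ℝ} (hs : SmoothStrong φ₁ μ L) {γ₁ : ℝ} (hγ : 1 < γ₁)
    {y : ℝ → Eucl n} {M : ℝ} (hM : γ₁ * L ≤ M) {T L' : ℝ} {x' : Eucl n} {m : ℕ}
    (hrun : LineSearch φ₁ φ₂ γ₁ y T L' x' m) (hT : 0 < T) (hTM : T ≤ M) (hμ : 0 < μ) :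
    (m : ℝ) ≤ 1 + 2 / Real.log γ₁ * (√(M / μ) * √(μ / T)) := by
  obtain ⟨h1, h2, -, -, h5⟩ := hrun.bounds hs hγ hM hT hTM
  have hlog : 0 < Real.log γ₁ := Real.log_pos hγ
  have hMp : 0 < M := hT.trans_le hTM
  have h6 : Real.log (L' / T) ≤ 2 * √(M / T) :=
    (Real.log_le_log (div_pos (hT.trans_le h1) hT) (by gcongr)).trans
      (log_le_two_mul_sqrt (by positivity))
  have h7 : √(M / μ) * √(μ / T) = √(M / T) := by
    rw [← Real.sqrt_mul (by positivity)]
    congr 1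
    field_simp
  rw [h7]
  refine h5.trans ?_
  have h8 : Real.log (L' / T) / Real.log γ₁ ≤ 2 * √(M / T) / Real.log γ₁ := by gcongr
  calc _ ≤ 1 + 2 * √(M / T) / Real.log γ₁ := by linarith
    _ = _ := by ring

/-! ### The whole method -/

/-- Standing hypotheses on a run of the method: `M` bounds all accepted trial values, `xs`
minimizes `φ₁ + φ₂`. -/
structure APGSetting (φ₁ : Eucl n → ℝ) (φ₂ : Eucl n → EReal) (prm : APGParams) (μ L M : ℝ)
    (xs : Eucl n) : Prop where
  plc : ProperLscConvex φ₂
  smooth : SmoothStrong φ₁ μ L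
  Lmin_pos : 0 < prm.Lmin
  one_lt : 1 < prm.γ₁
  one_le : 1 ≤ prm.γ₂
  mu_pos : 0 < μ
  mu_le : 4 * μ ≤ prm.Lmin
  L_nonneg : 0 ≤ L
  Lmin_le : prm.Lmin ≤ M
  mul_le : prm.γ₁ * L ≤ M
  xs_mem : xs ∈ effDom φ₂
  xs_min : ∀ u ∈ effDom φ₂, realSum φ₁ φ₂ xs ≤ realSum φ₁ φ₂ u

/-- The energy below which the stopping test for the tolerance `δ` succeeds. -/
def stopLevel (prm : APGParams) (M δ : ℝ) : ℝ := δ ^ 2 * prm.Lmin / (8 * M ^ 2)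

namespace APGSetting

variable {prm : APGParams} {μ L M : ℝ} {xs : Eucl n}

theorem M_pos (S : APGSetting φ₁ φ₂ prm μ L M xs) : 0 < M := S.Lmin_pos.trans_le S.Lmin_le

theorem sqrt_le (S : APGSetting φ₁ φ₂ prm μ L M xs) {T : ℝ} (hT : prm.Lmin ≤ T) :
    √(μ / T) ≤ 1 / 2 := by
  have hT0 : 0 < T := S.Lmin_pos.trans_le hT
  rw [Real.sqrt_le_left (by norm_num), div_le_iff₀ hT0]
  linarith [S.mu_le]

theorem one_le_sqrt_mul (S : APGSetting φ₁ φ₂ prm μ L M xs) {T : ℝ} (hT : 0 < T) (hTM : T ≤ M) :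
    1 ≤ √(M / μ) * √(μ / T) := by
  have hμ := S.mu_pos
  have hM := S.M_pos
  rw [← Real.sqrt_mul (by positivity), Real.one_le_sqrt]
  have e : M / μ * (μ / T) = M / T := by field_simp
  rw [e, one_le_div hT]
  exact hTM

theorem energy_nonneg (S : APGSetting φ₁ φ₂ prm μ L M xs) {xprev x : Eucl n} {αprev : ℝ}
    (hx : x ∈ effDom φ₂) : 0 ≤ apgEnergy φ₁ φ₂ μ xs xprev x αprev := by
  have h1 := S.xs_min x hx
  have h2 := S.mu_pos
  have h3 : 0 ≤ μ / 2 * ‖xprev + (1 / αprev) • (x - xprev) - xs‖ ^ 2 := by positivity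
  unfold apgEnergy
  linarith

theorem sub_le_energy (S : APGSetting φ₁ φ₂ prm μ L M xs) {xprev x : Eucl n} {αprev : ℝ} :
    realSum φ₁ φ₂ x - realSum φ₁ φ₂ xs ≤ apgEnergy φ₁ φ₂ μ xs xprev x αprev := by
  have h2 := S.mu_pos
  have h3 : 0 ≤ μ / 2 * ‖xprev + (1 / αprev) • (x - xprev) - xs‖ ^ 2 := by positivity
  unfold apgEnergy
  linarith

/-- Applying `prox_step_le` with `u = y = x` bounds `T/2 ‖x - xh‖²` by the objective gap, so `‖x -
xh‖ ≤ δ / (2 M)`; the residual factor `T + L` is at most `2 M`. -/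
theorem nearStationary (S : APGSetting φ₁ φ₂ prm μ L M xs) {x xh : Eucl n} {T δ : ℝ}
    (hT : prm.Lmin ≤ T) (hTM : T ≤ M) (hδ : 0 ≤ δ) (hx : x ∈ effDom φ₂)
    (hstep : IsProxStep φ₁ φ₂ T x xh) (ht : DescentTest φ₁ T x xh)
    (hE : realSum φ₁ φ₂ x - realSum φ₁ φ₂ xs ≤ stopLevel prm M δ) :
    NearStationary (fun u => (φ₁ u : EReal) + φ₂ u) δ xh := by
  have hT0 : 0 < T := S.Lmin_pos.trans_le hT
  have hM := S.M_pos
  have hl := S.Lmin_pos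
  refine nearStationary_of_prox_step S.plc S.mu_pos.le S.smooth hT0 hstep ?_
  have h1 := prox_step_le S.plc S.smooth hT0 hstep ht hx
  have h2 := S.xs_min xh (hstep.variational S.plc hT0).1
  simp only [sub_self, inner_zero_right, norm_zero, mul_zero, add_zero] at h1
  have h3 : T / 2 * ‖x - xh‖ ^ 2 ≤ stopLevel prm M δ := by norm_num at h1; linarith
  have h4 : prm.Lmin / 2 * ‖x - xh‖ ^ 2 ≤ T / 2 * ‖x - xh‖ ^ 2 := by gcongr
  have h5 : prm.Lmin / 2 * ‖x - xh‖ ^ 2 ≤ prm.Lmin / 2 * (δ / (2 * M)) ^ 2 := by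
    refine (h4.trans h3).trans_eq ?_
    unfold stopLevel
    field_simp
    ring
  have h6 : ‖x - xh‖ ≤ δ / (2 * M) :=
    le_of_sq_le_sq (le_of_mul_le_mul_left h5 (by positivity)) (by positivity)
  have hLM : L ≤ M := le_trans (le_mul_of_one_le_left S.L_nonneg S.one_lt.le) S.mul_le
  calc (T + L) * ‖x - xh‖ ≤ (2 * M) * (δ / (2 * M)) := by
        have := S.L_nonneg
        gcongr
        linarith
    _ = δ := by field_simp

/-- The weight of the trial value at the start of an iteration in the cost of the iteration. -/
def costA (prm : APGParams) : ℝ := 8 / Real.log prm.γ₁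

/-- The weight of the logarithm of the energy in the number of oracle queries. -/
def costB (prm : APGParams) : ℝ := 10 + costA prm + costA prm * √prm.γ₂

theorem costA_nonneg (S : APGSetting φ₁ φ₂ prm μ L M xs) : 0 ≤ costA prm :=
  div_nonneg (by norm_num) (Real.log_pos S.one_lt).le

theorem iteration (S : APGSetting φ₁ φ₂ prm μ L M xs) {xprev x : Eucl n} {αprev T : ℝ}
    (hx : x ∈ effDom φ₂) (hα : 0 < αprev) (hT : prm.Lmin ≤ T) (hTM : T ≤ M)
    {Lt : ℝ} {xt xh : Eucl n} {N : ℕ}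
    (hit : APGIteration φ₁ φ₂ prm μ xprev x αprev T Lt xt xh N) :
    xt ∈ effDom φ₂ ∧ prm.Lmin ≤ Lt ∧ Lt ≤ M ∧
      apgEnergy φ₁ φ₂ μ xs x xt √(μ / Lt)
        ≤ (1 - √(μ / Lt)) * apgEnergy φ₁ φ₂ μ xs xprev x αprev ∧
      (N : ℝ) ≤ √(M / μ) * ((10 + costA prm) * √(μ / Lt) + costA prm * √(μ / T)) ∧
      ∀ δ, 0 ≤ δ → apgEnergy φ₁ φ₂ μ xs x xt √(μ / Lt) ≤ stopLevel prm M δ →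
        NearStationary (fun u => (φ₁ u : EReal) + φ₂ u) δ xh := by
  obtain ⟨Lh, m₁, m₂, r1, r2, rfl⟩ := hit
  have hT0 : 0 < T := S.Lmin_pos.trans_le hT
  obtain ⟨b1, b2, b3, b4, -⟩ := r1.bounds S.smooth S.one_lt S.mul_le hT0 hTM
  have hLt : prm.Lmin ≤ Lt := hT.trans b1
  have hLt0 : 0 < Lt := S.Lmin_pos.trans_le hLt
  obtain ⟨d1, d2, d3, d4, -⟩ := r2.bounds S.smooth S.one_lt S.mul_le hLt0 b2
  have hxt := (b3.variational S.plc hLt0).1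
  refine ⟨hxt, hLt, b2, ?_, ?_, fun δ hδ hE => ?_⟩
  · exact apgEnergy_step S.plc S.smooth hLt0 S.mu_pos (by linarith [S.mu_le, S.mu_pos]) hα hx
      S.xs_mem b3 b4
  · have c1 := r1.passes_le S.smooth S.one_lt S.mul_le hT0 hTM S.mu_pos
    have c2 := r2.passes_le S.smooth S.one_lt S.mul_le hLt0 b2 S.mu_pos
    -- The fixed cost `4 + 4 + 2 = 10` of an iteration is charged to the same product, which is at
    -- least one.
    have c3 := S.one_le_sqrt_mul hLt0 b2
    have e : costA prm = 4 * (2 / Real.log prm.γ₁) := by unfold costA; ring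
    rw [e]
    push_cast
    linarith
  · exact S.nearStationary (hLt.trans d1) d2 hδ hxt d3 d4 (S.sub_le_energy.trans hE)

theorem exists_iteration (S : APGSetting φ₁ φ₂ prm μ L M xs) (xprev x : Eucl n) (αprev : ℝ) {T : ℝ}
    (hT : prm.Lmin ≤ T) (hTM : T ≤ M) :
    ∃ Lt xt xh N, APGIteration φ₁ φ₂ prm μ xprev x αprev T Lt xt xh N := by
  have hT0 : 0 < T := S.Lmin_pos.trans_le hT
  obtain ⟨Lt, xt, m₁, r1⟩ := LineSearch.exists_run S.plc S.smooth S.one_lt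
    (extrapolate μ xprev x αprev) hT0
  have b := r1.bounds S.smooth S.one_lt S.mul_le hT0 hTM
  obtain ⟨Lh, xh, m₂, r2⟩ := LineSearch.exists_run S.plc S.smooth S.one_lt
    (fun _ => xt) (hT0.trans_le b.1)
  exact ⟨Lt, xt, xh, _, Lh, m₁, m₂, r1, r2, rfl⟩

theorem restart_bounds (S : APGSetting φ₁ φ₂ prm μ L M xs) {Lt : ℝ} (h1 : prm.Lmin ≤ Lt)
    (h2 : Lt ≤ M) : prm.Lmin ≤ max prm.Lmin (Lt / prm.γ₂) ∧ max prm.Lmin (Lt / prm.γ₂) ≤ M := by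
  refine ⟨le_max_left _ _, max_le S.Lmin_le (le_trans ?_ h2)⟩
  exact div_le_self (S.Lmin_pos.le.trans h1) S.one_le

/-- Accepted values stay below `M`, so every iteration contracts the energy at least by `1 -
√(μ/M)`, and it reaches `stopLevel` in finitely many steps. -/
theorem exists_loop (S : APGSetting φ₁ φ₂ prm μ L M xs) {δ : ℝ} (hδ : 0 < δ) {xprev x : Eucl n}
    {αprev T : ℝ} (hx : x ∈ effDom φ₂) (hα : 0 < αprev) (hT : prm.Lmin ≤ T) (hTM : T ≤ M) :
    ∃ xout N, APGLoop φ₁ φ₂ prm μ δ xprev x αprev T xout N := by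
  have hM := S.M_pos
  have hμ := S.mu_pos
  have hl := S.Lmin_pos
  have hτ : 0 < stopLevel prm M δ := by unfold stopLevel; positivity
  set q := 1 - √(μ / M) with hq
  have hq1 : q < 1 := by
    have : 0 < √(μ / M) := Real.sqrt_pos.2 (by positivity)
    linarith
  have hq0 : 0 < q := by linarith [S.sqrt_le S.Lmin_le]
  obtain ⟨j, hj⟩ : ∃ j : ℕ, q ^ j * apgEnergy φ₁ φ₂ μ xs xprev x αprev ≤ stopLevel prm M δ := by
    rcases (S.energy_nonneg (xprev := xprev) (αprev := αprev) hx).eq_or_lt with h0 | h0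
    · exact ⟨0, by rw [← h0]; simpa using hτ.le⟩
    · obtain ⟨j, hj⟩ := exists_pow_lt_of_lt_one (div_pos hτ h0) hq1
      exact ⟨j, ((lt_div_iff₀ h0).1 hj).le⟩
  induction j generalizing xprev x αprev T with
  | zero =>
    obtain ⟨Lt, xt, xh, N, hit⟩ := S.exists_iteration xprev x αprev hT hTM
    obtain ⟨i1, i2, i3, i4, -, i6⟩ := S.iteration hx hα hT hTM hit
    refine ⟨xh, N, .finish _ _ _ _ _ _ _ _ hit (i6 δ hδ.le (i4.trans ?_))⟩
    rw [pow_zero, one_mul] at hj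
    refine le_trans ?_ hj
    refine mul_le_of_le_one_left (S.energy_nonneg hx) ?_
    linarith [Real.sqrt_nonneg (μ / Lt)]
  | succ j ih =>
    obtain ⟨Lt, xt, xh, N, hit⟩ := S.exists_iteration xprev x αprev hT hTM
    obtain ⟨i1, i2, i3, i4, -, i6⟩ := S.iteration hx hα hT hTM hit
    by_cases hst : NearStationary (fun u => (φ₁ u : EReal) + φ₂ u) δ xh
    · exact ⟨xh, N, .finish _ _ _ _ _ _ _ _ hit hst⟩
    · have hLt0 : 0 < Lt := hl.trans_le i2
      obtain ⟨k1, k2⟩ := S.restart_bounds i2 i3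
      obtain ⟨xout, N', hrest⟩ := ih (xprev := x) (x := xt) (αprev := √(μ / Lt)) i1
        (Real.sqrt_pos.2 (by positivity)) k1 k2 (by
          refine le_trans ?_ hj
          rw [pow_succ, mul_assoc]
          refine mul_le_mul_of_nonneg_left (i4.trans ?_) (by positivity)
          refine mul_le_mul_of_nonneg_right ?_ (S.energy_nonneg hx)
          have : √(μ / M) ≤ √(μ / Lt) := by gcongr
          linarith)
      exact ⟨xout, N + N', .next _ _ _ _ _ _ _ _ _ _ hit hst hrest⟩

/-- Amortization with two potentials: the log-energy pays for the passes at the accepted value and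
for the next restart value, while `costA √(μ/T)` carries the prepaid cost of the search that starts
at `T`. The summand `1` pays for the final iteration, whose energy may already be below `stopLevel`.
-/
theorem loop_cost (S : APGSetting φ₁ φ₂ prm μ L M xs) {δ : ℝ} (hδ : 0 < δ) {xprev x : Eucl n}
    {αprev T : ℝ} {xout : Eucl n} {N : ℕ} (hrun : APGLoop φ₁ φ₂ prm μ δ xprev x αprev T xout N)
    (hx : x ∈ effDom φ₂) (hα : 0 < αprev) (hT : prm.Lmin ≤ T) (hTM : T ≤ M) :
    NearStationary (fun u => (φ₁ u : EReal) + φ₂ u) δ xout ∧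
    (N : ℝ) ≤ √(M / μ) * (costA prm * √(μ / T) + costB prm *
      (1 + max 0 (Real.log (apgEnergy φ₁ φ₂ μ xs xprev x αprev / stopLevel prm M δ)))) := by
  have hM := S.M_pos
  have hμ := S.mu_pos
  have hl := S.Lmin_pos
  have hA := S.costA_nonneg
  have hγ₂ : 0 < prm.γ₂ := by linarith [S.one_le]
  have hB : 0 ≤ costB prm := by unfold costB; positivity
  have hτ : 0 < stopLevel prm M δ := by unfold stopLevel; positivity
  induction hrun with
  | finish xprev x αprev T Lt xt xh N hit hst =>
    refine ⟨hst, ?_⟩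
    obtain ⟨i1, i2, i3, i4, i5, -⟩ := S.iteration hx hα hT hTM hit
    refine i5.trans (mul_le_mul_of_nonneg_left ?_ (Real.sqrt_nonneg _))
    have h1 := S.sqrt_le i2
    have h2 : (10 + costA prm) * √(μ / Lt) ≤ costB prm := by
      calc (10 + costA prm) * √(μ / Lt) ≤ (10 + costA prm) * 1 := by gcongr; linarith
        _ ≤ costB prm := by
          unfold costB
          have : 0 ≤ costA prm * √prm.γ₂ := by positivity
          linarith
    have h3 := mul_nonneg hB (le_max_left 0
      (Real.log (apgEnergy φ₁ φ₂ μ xs xprev x αprev / stopLevel prm M δ)))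
    linarith
  | next xprev x αprev T Lt xt xh N xout N' hit hst hrest ih =>
    obtain ⟨i1, i2, i3, i4, i5, i6⟩ := S.iteration hx hα hT hTM hit
    have hLt0 : 0 < Lt := hl.trans_le i2
    have hα' : 0 < √(μ / Lt) := Real.sqrt_pos.2 (by positivity)
    obtain ⟨k1, k2⟩ := S.restart_bounds i2 i3
    obtain ⟨j1, j2⟩ := ih i1 hα' k1 k2
    refine ⟨j1, ?_⟩
    set α := √(μ / Lt) with hαdef
    set E := apgEnergy φ₁ φ₂ μ xs xprev x αprev
    set E' := apgEnergy φ₁ φ₂ μ xs x xt α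
    -- Failure of the stopping test keeps the energy above the threshold, so the truncated logarithm
    -- is the genuine one and does drop by `α`.
    have hE' : stopLevel prm M δ < E' := by
      by_contra! hcon
      exact hst (i6 δ hδ.le hcon)
    have hα1 := S.sqrt_le i2
    have hE'0 : 0 < E' := hτ.trans hE'
    have hE0 : 0 < E := by
      by_contra! hcon
      nlinarith
    have hlog : Real.log (E' / stopLevel prm M δ) ≤ Real.log (E / stopLevel prm M δ) - α := by
      have l1 : Real.log (E' / stopLevel prm M δ)
          ≤ Real.log ((1 - α) * (E / stopLevel prm M δ)) := by
        refine Real.log_le_log (by positivity) ?_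
        rw [← mul_div_assoc]
        gcongr
      rw [Real.log_mul (by linarith) (by positivity)] at l1
      have l2 := Real.log_le_sub_one_of_pos (by linarith : 0 < 1 - α)
      linarith
    have hlog0 : 0 ≤ Real.log (E' / stopLevel prm M δ) :=
      Real.log_nonneg ((one_le_div hτ).2 hE'.le)
    rw [max_eq_right hlog0] at j2
    rw [max_eq_right (by linarith)]
    -- Restarting from no less than `Lt / γ₂` loses at most a factor `√γ₂`, which explains the last
    -- term of `costB`.
    have hβ : √(μ / max prm.Lmin (Lt / prm.γ₂)) ≤ √prm.γ₂ * α := by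
      rw [hαdef, ← Real.sqrt_mul hγ₂.le]
      refine Real.sqrt_le_sqrt ?_
      calc μ / max prm.Lmin (Lt / prm.γ₂) ≤ μ / (Lt / prm.γ₂) := by
            gcongr; exact le_max_right _ _
        _ = prm.γ₂ * (μ / Lt) := by field_simp
    push_cast
    have hfin : (10 + costA prm) * α + costA prm * √(μ / T)
        + (costA prm * √(μ / max prm.Lmin (Lt / prm.γ₂))
          + costB prm * (1 + Real.log (E' / stopLevel prm M δ)))
        ≤ costA prm * √(μ / T) + costB prm * (1 + Real.log (E / stopLevel prm M δ)) := by
      have m1 := mul_le_mul_of_nonneg_left hβ hA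
      have m2 := mul_le_mul_of_nonneg_left hlog hB
      have m3 : costB prm * α = (10 + costA prm) * α + costA prm * (√prm.γ₂ * α) := by
        unfold costB; ring
      linarith
    have hR := mul_le_mul_of_nonneg_left hfin (Real.sqrt_nonneg (M / μ))
    linarith

/-- The constant in the complexity bound of the method. -/
def costC (prm : APGParams) : ℝ := 4 + 2 * costA prm + costB prm

theorem exists_run (S : APGSetting φ₁ φ₂ prm μ L M xs) {δ : ℝ} (hδ : 0 < δ) (y₀ : Eucl n) :
    ∃ xout N, APG φ₁ φ₂ prm μ δ y₀ xout N := by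
  obtain ⟨Lt, xt, m, r⟩ := LineSearch.exists_run S.plc S.smooth S.one_lt (fun _ => y₀) S.Lmin_pos
  obtain ⟨b1, b2, b3, -, -⟩ := r.bounds S.smooth S.one_lt S.mul_le S.Lmin_pos S.Lmin_le
  obtain ⟨k1, k2⟩ := S.restart_bounds b1 b2
  obtain ⟨xout, N', hloop⟩ := S.exists_loop hδ (xprev := xt)
    (b3.variational S.plc (S.Lmin_pos.trans_le b1)).1 one_pos k1 k2
  exact ⟨xout, _, Lt, xt, m, N', r, hloop, rfl⟩

/-- Here `exp Λ` bounds the ratio of the initial energy, at most `M/2 ρ²`, to the stopping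
threshold. The initial line search accounts for the extra `4 + costA`. -/
theorem cost (S : APGSetting φ₁ φ₂ prm μ L M xs) {δ ρ Λ : ℝ} (hδ : 0 < δ) {y₀ xout : Eucl n}
    {N : ℕ} (hrun : APG φ₁ φ₂ prm μ δ y₀ xout N) (hρ : ‖xs - y₀‖ ≤ ρ) (hΛ : 0 ≤ Λ)
    (hbound : M / 2 * ρ ^ 2 ≤ stopLevel prm M δ * Real.exp Λ) :
    NearStationary (fun u => (φ₁ u : EReal) + φ₂ u) δ xout ∧
    (N : ℝ) ≤ costC prm * √(M / μ) * (1 + Λ) := by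
  obtain ⟨Lt, xt, m, N', r, hloop, rfl⟩ := hrun
  obtain ⟨b1, b2, b3, b4, -⟩ := r.bounds S.smooth S.one_lt S.mul_le S.Lmin_pos S.Lmin_le
  obtain ⟨k1, k2⟩ := S.restart_bounds b1 b2
  have hM := S.M_pos
  have hμ := S.mu_pos
  have hl := S.Lmin_pos
  have hLt0 : 0 < Lt := hl.trans_le b1
  have hxt := (b3.variational S.plc hLt0).1
  obtain ⟨c1, c2⟩ := S.loop_cost hδ hloop hxt one_pos k1 k2
  refine ⟨c1, ?_⟩
  have hA := S.costA_nonneg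
  have hB : 0 ≤ costB prm := by unfold costB; positivity
  have hτ : 0 < stopLevel prm M δ := by unfold stopLevel; positivity
  have c3 := r.passes_le S.smooth S.one_lt S.mul_le S.Lmin_pos S.Lmin_le S.mu_pos
  have c4 := S.sqrt_le le_rfl
  have c5 := S.sqrt_le k1
  have c6 : 1 ≤ √(M / μ) := by
    rw [Real.one_le_sqrt, one_le_div hμ]
    linarith [S.mu_le, S.Lmin_le]
  have c7 : max 0 (Real.log (apgEnergy φ₁ φ₂ μ xs xt xt 1 / stopLevel prm M δ)) ≤ Λ := by
    refine max_le hΛ ?_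
    rcases (S.energy_nonneg (xprev := xt) (αprev := 1) hxt).eq_or_lt with h0 | h0
    · rw [← h0]; simpa using hΛ
    · rw [Real.log_le_iff_le_exp (by positivity), div_le_iff₀ hτ, mul_comm]
      refine le_trans ?_ hbound
      refine (apgEnergy_init S.plc S.smooth hLt0 (by linarith [S.mu_le]) S.mu_pos.le S.xs_mem b3
        b4).trans ?_
      gcongr
  have hR0 : 0 ≤ √(M / μ) := by linarith
  have e : costA prm = 4 * (2 / Real.log prm.γ₁) := by unfold costA; ring
  have d1 : 4 * (m : ℝ) ≤ √(M / μ) * (4 + costA prm) := by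
    have : costA prm * (√(M / μ) * √(μ / prm.Lmin)) ≤ costA prm * (√(M / μ) * 1) := by
      gcongr; linarith
    rw [e] at this ⊢
    linarith
  have d2 : (N' : ℝ) ≤ √(M / μ) * (costA prm * 1 + costB prm * (1 + Λ)) := by
    refine c2.trans ?_
    gcongr
    linarith
  have d3 : 0 ≤ √(M / μ) * (4 + 2 * costA prm) * Λ := by positivity
  unfold costC
  push_cast
  linarith

end APGSetting

end APG

/-! ### Conic combinations of extended-real-valued convex functions -/

section AddMul

variable {n : ℕ} {φ ψ : Eucl n → EReal}

theorem coe_add_of_mem_effDom (hb : ∀ x, φ x ≠ ⊥) {x : Eucl n} (hx : x ∈ effDom φ) (a : ℝ) :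
    (a : EReal) + φ x = ((a + (φ x).toReal : ℝ) : EReal) := by
  rw [EReal.coe_add, coe_toReal_of_mem_effDom hb hx]

theorem add_coe_mul_eq (hφ : ∀ x, φ x ≠ ⊥) (hψ : ∀ x, ψ x ≠ ⊥) {z : ℝ} {x : Eucl n}
    (hx : x ∈ effDom φ) (hz : z = 0 ∨ x ∈ effDom ψ) :
    φ x + (z : EReal) * ψ x = (((φ x).toReal + z * (ψ x).toReal : ℝ) : EReal) := by
  rcases hz with rfl | hz
  · simp [coe_toReal_of_mem_effDom hφ hx]
  · rw [EReal.coe_add, EReal.coe_mul, coe_toReal_of_mem_effDom hφ hx,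
      coe_toReal_of_mem_effDom hψ hz]

theorem coe_mul_ne_bot (hψ : ∀ x, ψ x ≠ ⊥) {z : ℝ} (hz : 0 ≤ z) (x : Eucl n) :
    (z : EReal) * ψ x ≠ ⊥ := by
  rcases hz.eq_or_lt with rfl | hz
  · simp
  · by_cases hx : x ∈ effDom ψ
    · rw [← coe_toReal_of_mem_effDom hψ hx, ← EReal.coe_mul]
      exact EReal.coe_ne_bot _
    · rw [eq_top_of_notMem_effDom hx, EReal.coe_mul_top_of_pos hz]
      exact bot_lt_top.ne'

theorem mem_effDom_add_mul (hφ : ∀ x, φ x ≠ ⊥) (hψ : ∀ x, ψ x ≠ ⊥) {z : ℝ} (hz : 0 ≤ z)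
    {x : Eucl n} : x ∈ effDom (fun x => φ x + (z : EReal) * ψ x) ↔
      x ∈ effDom φ ∧ (z = 0 ∨ x ∈ effDom ψ) := by
  constructor
  · intro h
    have h1 : φ x + (z : EReal) * ψ x < ⊤ := h
    have hx : x ∈ effDom φ := by
      by_contra hcon
      rw [eq_top_of_notMem_effDom hcon, EReal.top_add_of_ne_bot (coe_mul_ne_bot hψ hz x)] at h1
      exact lt_irrefl _ h1
    refine ⟨hx, ?_⟩
    by_contra! hcon
    rw [eq_top_of_notMem_effDom hcon.2, EReal.coe_mul_top_of_pos (lt_of_le_of_ne hz hcon.1.symm),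
      EReal.add_top_of_ne_bot (hφ x)] at h1
    exact lt_irrefl _ h1
  · rintro ⟨h1, h2⟩
    change φ x + (z : EReal) * ψ x < ⊤
    rw [add_coe_mul_eq hφ hψ h1 h2]
    exact EReal.coe_lt_top _

theorem ProperLscConvex.add_mul (hφ : ProperLscConvex φ) (hψ : ProperLscConvex ψ) {z : ℝ}
    (hz : 0 ≤ z) (hne : ∃ x, x ∈ effDom φ ∧ x ∈ effDom ψ) :
    ProperLscConvex (fun x => φ x + (z : EReal) * ψ x) := by
  -- Since `0 · ∞ = 0`, the domain at `z = 0` is that of `φ` alone, not the intersection.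
  rcases hz.eq_or_lt with rfl | hz0
  · simpa using hφ
  have hb : ∀ x, φ x + (z : EReal) * ψ x ≠ ⊥ := fun x =>
    EReal.add_ne_bot_iff.2 ⟨hφ.ne_bot x, coe_mul_ne_bot hψ.ne_bot hz x⟩
  refine ⟨hb, ?_, ?_, ?_⟩
  · obtain ⟨x, h1, h2⟩ := hne
    exact ⟨x, ((mem_effDom_add_mul hφ.ne_bot hψ.ne_bot hz).2 ⟨h1, Or.inr h2⟩).ne⟩
  · have hz' : (z : EReal) ≠ 0 := by exact_mod_cast hz0.ne'
    refine LowerSemicontinuous.add' hφ.lsc (fun x => ?_) fun x => ?_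
    · have hmul : ContinuousAt (fun a : EReal => (z : EReal) * a) (ψ x) :=
        (EReal.continuousAt_mul (p := ((z : EReal), ψ x)) (Or.inl hz') (Or.inl hz')
          (Or.inl (EReal.coe_ne_bot z)) (Or.inl (EReal.coe_ne_top z))).comp
          (continuousAt_const.prodMk continuousAt_id)
      exact hmul.comp_lowerSemicontinuousAt (hψ.lsc x)
        fun a b hab => mul_le_mul_of_nonneg_left hab (by exact_mod_cast hz)
    · exact EReal.continuousAt_add (Or.inr (coe_mul_ne_bot hψ.ne_bot hz x))
        (Or.inl (hφ.ne_bot x))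
  · refine convex_epi_of_convexOn hb ?_
    have hdom : effDom (fun x => φ x + (z : EReal) * ψ x) = effDom φ ∩ effDom ψ := by
      ext x
      rw [mem_effDom_add_mul hφ.ne_bot hψ.ne_bot hz]
      simp [hz0.ne']
    rw [hdom]
    have hconv : Convex ℝ (effDom φ ∩ effDom ψ) := hφ.convexOn.1.inter hψ.convexOn.1
    have h := (hφ.convexOn.subset Set.inter_subset_left hconv).add
      ((hψ.convexOn.subset Set.inter_subset_right hconv).smul hz)
    refine h.congr fun x hx => ?_
    simp only [Pi.add_apply, smul_eq_mul]
    rw [add_coe_mul_eq hφ.ne_bot hψ.ne_bot hx.1 (Or.inr hx.2), EReal.toReal_coe]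

end AddMul

noncomputable section

/-! ### Real-valued forms of the bilevel data. -/

namespace Bilevel

variable {n : ℕ} (P : Bilevel n)

/-- The real-valued version of `f`, meaningful on `dom f₂`. -/
def fReal : Eucl n → ℝ := realSum P.f₁ P.f₂

/-- The real-valued version of `g`, meaningful on `dom g₂`. -/
def gReal : Eucl n → ℝ := realSum P.g₁ P.g₂

/-- `x` is an `ε²`-stationary point of the penalized function `g_ε + g₂ + z f`. -/
def NearOpt (x0 : Eucl n) (ε z : ℝ) (x : Eucl n) : Prop :=
  NearStationary (fun u => ((P.gEps x0 ε u + z * P.f₁ u : ℝ) : EReal)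
    + (P.g₂ u + (z : EReal) * P.f₂ u)) (ε ^ 2) x

/-- `f_c(x) ≤ ε₂`, with `f_c(x)` finite. -/
def Feasible (c ε₂ : ℝ) (x : Eucl n) : Prop := x ∈ effDom P.f₂ ∧ P.fReal x - c ≤ ε₂

variable {P}

theorem BasicAssumption.f_eq (hP : P.BasicAssumption) {x : Eucl n} (hx : x ∈ effDom P.f₂) :
    P.f x = (P.fReal x : EReal) := coe_add_of_mem_effDom hP.plc_f₂.ne_bot hx _

theorem BasicAssumption.g_eq (hP : P.BasicAssumption) {x : Eucl n} (hx : x ∈ effDom P.g₂) :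
    P.g x = (P.gReal x : EReal) := coe_add_of_mem_effDom hP.plc_g₂.ne_bot hx _

theorem mem_effDom_of_f_lt_top {x : Eucl n} (h : P.f x < ⊤) :
    x ∈ effDom P.f₂ := by
  by_contra hcon
  rw [f, eq_top_of_notMem_effDom hcon, EReal.coe_add_top] at h
  exact lt_irrefl _ h

theorem mem_effDom_of_g_lt_top {x : Eucl n} (h : P.g x < ⊤) :
    x ∈ effDom P.g₂ := by
  by_contra hcon
  rw [g, eq_top_of_notMem_effDom hcon, EReal.coe_add_top] at h
  exact lt_irrefl _ h

theorem BasicAssumption.mem_levSet_iff (hP : P.BasicAssumption) {x : Eucl n} {t : ℝ} :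
    x ∈ levSet P.g t ↔ x ∈ effDom P.g₂ ∧ P.gReal x ≤ t := by
  constructor
  · intro h
    have hx : x ∈ effDom P.g₂ := mem_effDom_of_g_lt_top (lt_of_le_of_lt h (EReal.coe_lt_top t))
    have h' : P.g x ≤ (t : EReal) := h
    rw [hP.g_eq hx] at h'
    exact ⟨hx, by exact_mod_cast h'⟩
  · rintro ⟨hx, h⟩
    change P.g x ≤ (t : EReal)
    rw [hP.g_eq hx]
    exact_mod_cast h

theorem BasicAssumption.fc_eq (hP : P.BasicAssumption) {x : Eucl n} (hx : x ∈ effDom P.f₂) (c : ℝ) :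
    P.fc c x = ((P.fReal x - c : ℝ) : EReal) := by
  rw [fc, coe_add_of_mem_effDom hP.plc_f₂.ne_bot hx, fReal, realSum]
  congr 1
  ring

theorem BasicAssumption.feasible_iff (hP : P.BasicAssumption) {x : Eucl n} {c ε₂ : ℝ}
    (h0 : 0 ≤ ε₂) : max (P.fc c x) 0 ≤ (ε₂ : EReal) ↔ P.Feasible c ε₂ x := by
  rw [max_le_iff, and_iff_left (by exact_mod_cast h0)]
  constructor
  · intro h
    have hx : x ∈ effDom P.f₂ := by
      by_contra hcon
      rw [fc, eq_top_of_notMem_effDom hcon, EReal.coe_add_top] at h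
      exact absurd h (not_le.2 (EReal.coe_lt_top _))
    rw [hP.fc_eq hx] at h
    exact ⟨hx, by exact_mod_cast h⟩
  · rintro ⟨hx, h⟩
    rw [hP.fc_eq hx]
    exact_mod_cast h

/-- Shifting `f` by a constant does not change the stationarity of the Lagrangian. -/
theorem NearOpt.nearStationary_lagr (hP : P.BasicAssumption)
    (hne : ∃ x, x ∈ effDom P.g₂ ∧ x ∈ effDom P.f₂) {x0 x : Eucl n} {ε z : ℝ} (hz : 0 ≤ z)
    (h : P.NearOpt x0 ε z x) (c : ℝ) : NearStationary (P.lagr x0 ε c z) (ε ^ 2) x := by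
  have hplc := hP.plc_g₂.add_mul hP.plc_f₂ hz hne
  have e : P.lagr x0 ε c z = fun u => ((P.gEps x0 ε u + z * (P.f₁ u - c) : ℝ) : EReal)
      + (P.g₂ u + (z : EReal) * P.f₂ u) := by
    funext u
    rw [lagr, fc, EReal.left_distrib_of_nonneg_of_ne_top (by exact_mod_cast hz)
      (EReal.coe_ne_top z), EReal.coe_add, EReal.coe_mul]
    abel
  rw [e]
  have hsub : subdiff (fun u => ((P.gEps x0 ε u + z * (P.f₁ u - c) : ℝ) : EReal)
      + (P.g₂ u + (z : EReal) * P.f₂ u)) x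
      = subdiff (fun u => ((P.gEps x0 ε u + z * P.f₁ u : ℝ) : EReal)
      + (P.g₂ u + (z : EReal) * P.f₂ u)) x := by
    ext v
    rw [mem_subdiff_add_iff hplc (φ₁ := fun u => P.gEps x0 ε u + z * (P.f₁ u - c)),
      mem_subdiff_add_iff hplc (φ₁ := fun u => P.gEps x0 ε u + z * P.f₁ u)]
    refine and_congr_right fun _ => forall₂_congr fun u _ => ?_
    constructor <;> intro h <;> linarith
  unfold NearStationary
  rw [hsub]
  exact h

theorem BasicAssumption.smoothStrong (hP : P.BasicAssumption) (x0 : Eucl n) {ε z : ℝ} (hε : 0 ≤ ε)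
    (hz : 0 ≤ z) : SmoothStrong (fun x => P.gEps x0 ε x + z * P.f₁ x) ε
      (P.Lg₁ + ε + z * P.Lf₁) := by
  have h1 := SmoothStrong.of_convex hP.convex_g₁ (hP.contDiff_g₁.differentiable (by norm_num))
    hP.lipschitz_g₁
  have h2 := SmoothStrong.of_convex hP.convex_f₁ (hP.contDiff_f₁.differentiable (by norm_num))
    hP.lipschitz_f₁
  have h3 := (h1.add_const_mul (smoothStrong_sq x0) (by positivity : 0 ≤ ε / 2)).add_const_mul h2 hz
  have e1 : 0 + ε / 2 * 2 + z * 0 = ε := by ring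
  have e2 : (P.Lg₁ : ℝ) + ε / 2 * 2 + z * P.Lf₁ = P.Lg₁ + ε + z * P.Lf₁ := by ring
  rw [e1, e2] at h3
  exact h3

/-- The standing hypotheses, with the explicit smallness requirements on `ε`. -/
structure Admissible (P : Bilevel n) (prm : APGParams) (x0 xg : Eucl n) (ε c Δ₁ D : ℝ) : Prop where
  basic : P.BasicAssumption
  Lmin_pos : 0 < prm.Lmin
  one_lt : 1 < prm.γ₁
  one_le : 1 ≤ prm.γ₂
  gap_pos : 0 < Δ₁
  reg : P.RegularCondition x0 xg ε c Δ₁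
  bdd : P.BoundedLevels prm.γ₁ x0 xg Δ₁
  one_le_D : 1 ≤ D
  Dz_le : P.Dz x0 xg Δ₁ ≤ D
  Dg_le : P.Dg prm.γ₁ x0 xg Δ₁ ≤ D
  eps_pos : 0 < ε
  eps_le : ε ≤ 1 / 4
  four_mul_le : 4 * ε ≤ prm.Lmin
  mul_D_le : ε * D ≤ Δ₁
  mul_D_mul_le : ε * D * Δ₁ ≤ 1
  two_mul_le : 2 * D * ε ≤ 1
  energy_small :
    4 * (max prm.Lmin (prm.γ₁ * (P.Lg₁ + 2 * D * P.Lf₁ + 1))) ^ 3 * D ^ 2 * ε ≤ prm.Lmin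

/-! ### Consequences of the standing hypotheses: near-optimal points, Lipschitz bounds and
complementary slackness. -/

namespace Admissible

variable {prm : APGParams} {x0 xg : Eucl n} {ε c Δ₁ D : ℝ}

theorem x0_mem_g (A : P.Admissible prm x0 xg ε c Δ₁ D) : x0 ∈ effDom P.g₂ :=
  mem_effDom_of_g_lt_top A.reg.g_x0

theorem xg_mem_f (A : P.Admissible prm x0 xg ε c Δ₁ D) : xg ∈ effDom P.f₂ :=
  mem_effDom_of_f_lt_top A.reg.f_xg

theorem x0_mem_f (A : P.Admissible prm x0 xg ε c Δ₁ D) : x0 ∈ effDom P.f₂ := by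
  by_contra hcon
  have h := A.reg.slater
  rw [fc, eq_top_of_notMem_effDom hcon, EReal.coe_add_top] at h
  exact not_top_lt h

theorem f_x0_lt (A : P.Admissible prm x0 xg ε c Δ₁ D) : P.fReal x0 - c < -Δ₁ := by
  have h := A.reg.slater
  rw [A.basic.fc_eq A.x0_mem_f] at h
  exact_mod_cast h

theorem g_xg_le' (A : P.Admissible prm x0 xg ε c Δ₁ D) {u : Eucl n} (hu : u ∈ effDom P.g₂) :
    P.g xg ≤ ((P.gReal u + ε : ℝ) : EReal) := by
  refine A.reg.g_xg.trans ?_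
  rw [EReal.coe_add, ← A.basic.g_eq hu]
  gcongr
  exact iInf_le _ u

theorem xg_mem_g (A : P.Admissible prm x0 xg ε c Δ₁ D) : xg ∈ effDom P.g₂ :=
  mem_effDom_of_g_lt_top ((A.g_xg_le' A.x0_mem_g).trans_lt (EReal.coe_lt_top _))

theorem g_xg_le (A : P.Admissible prm x0 xg ε c Δ₁ D) {u : Eucl n} (hu : u ∈ effDom P.g₂) :
    P.gReal xg ≤ P.gReal u + ε := by
  have h := A.g_xg_le' hu
  rw [A.basic.g_eq A.xg_mem_g] at h
  exact_mod_cast h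

theorem u₀_eq (A : P.Admissible prm x0 xg ε c Δ₁ D) : P.u₀ xg = P.fReal xg := by
  rw [u₀, A.basic.f_eq A.xg_mem_f, EReal.toReal_coe]

theorem c_le (A : P.Admissible prm x0 xg ε c Δ₁ D) : c ≤ P.fReal xg := A.u₀_eq ▸ A.reg.c_le

theorem Dz_mul (A : P.Admissible prm x0 xg ε c Δ₁ D) :
    P.Dz x0 xg Δ₁ * Δ₁ = P.gReal x0 - P.gReal xg + 1 := by
  rw [Dz, A.basic.g_eq A.x0_mem_g, A.basic.g_eq A.xg_mem_g, EReal.toReal_coe, EReal.toReal_coe,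
    div_mul_cancel₀ _ A.gap_pos.ne']

theorem half_le_Dz_mul (A : P.Admissible prm x0 xg ε c Δ₁ D) : 1 / 2 ≤ P.Dz x0 xg Δ₁ * Δ₁ := by
  rw [A.Dz_mul]
  linarith [A.g_xg_le A.x0_mem_g, A.eps_le]

theorem Dz_pos (A : P.Admissible prm x0 xg ε c Δ₁ D) : 0 < P.Dz x0 xg Δ₁ := by
  by_contra! hcon
  have := A.half_le_Dz_mul
  nlinarith [A.gap_pos]

theorem fStar_le (A : P.Admissible prm x0 xg ε c Δ₁ D) {u : Eucl n} (hg : u ∈ effDom P.g₂)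
    (hf : u ∈ effDom P.f₂) : P.fStar.toReal ≤ P.fReal u := by
  have hle : P.fStar ≤ (P.fReal u : EReal) := by
    rw [← A.basic.f_eq hf]
    refine iInf₂_le u ⟨?_, ?_⟩
    · change P.f u < ⊤
      rw [A.basic.f_eq hf]
      exact EReal.coe_lt_top _
    · change P.g u < ⊤
      rw [A.basic.g_eq hg]
      exact EReal.coe_lt_top _
  have h := EReal.toReal_le_toReal hle A.basic.bddBelow_f.ne' (EReal.coe_ne_top _)
  rwa [EReal.toReal_coe] at h

theorem plc (A : P.Admissible prm x0 xg ε c Δ₁ D) {z : ℝ} (hz : 0 ≤ z) :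
    ProperLscConvex (fun x => P.g₂ x + (z : EReal) * P.f₂ x) :=
  A.basic.plc_g₂.add_mul A.basic.plc_f₂ hz ⟨x0, A.x0_mem_g, A.x0_mem_f⟩

theorem realSum_eq (A : P.Admissible prm x0 xg ε c Δ₁ D) {z : ℝ} {u : Eucl n}
    (hg : u ∈ effDom P.g₂) (hf : z = 0 ∨ u ∈ effDom P.f₂) :
    P.gEps x0 ε u + z * P.f₁ u + (P.g₂ u + (z : EReal) * P.f₂ u).toReal
      = P.gReal u + ε / 2 * ‖u - x0‖ ^ 2 + z * P.fReal u := by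
  rw [add_coe_mul_eq A.basic.plc_g₂.ne_bot A.basic.plc_f₂.ne_bot hg hf, EReal.toReal_coe]
  unfold gEps gReal fReal realSum
  ring

theorem nearOpt_mem (A : P.Admissible prm x0 xg ε c Δ₁ D) {z : ℝ} (hz : 0 ≤ z) {x : Eucl n}
    (h : P.NearOpt x0 ε z x) : x ∈ effDom P.g₂ ∧ (z = 0 ∨ x ∈ effDom P.f₂) :=
  (mem_effDom_add_mul A.basic.plc_g₂.ne_bot A.basic.plc_f₂.ne_bot hz).1
    (NearStationary.mem_effDom (φ₁ := fun u => P.gEps x0 ε u + z * P.f₁ u) (A.plc hz)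
      (by positivity) h)

theorem nearOpt_growth (A : P.Admissible prm x0 xg ε c Δ₁ D) {z : ℝ} (hz : 0 ≤ z) {x : Eucl n}
    (h : P.NearOpt x0 ε z x) {u : Eucl n} (hg : u ∈ effDom P.g₂) (hf : z = 0 ∨ u ∈ effDom P.f₂) :
    P.gReal x + ε / 2 * ‖x - x0‖ ^ 2 + z * P.fReal x - ε ^ 2 * ‖u - x‖ + ε / 2 * ‖u - x‖ ^ 2
      ≤ P.gReal u + ε / 2 * ‖u - x0‖ ^ 2 + z * P.fReal u := by
  obtain ⟨h1, h2⟩ := A.nearOpt_mem hz h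
  have h3 := NearStationary.growth (φ₁ := fun u => P.gEps x0 ε u + z * P.f₁ u) (A.plc hz)
    (A.basic.smoothStrong x0 A.eps_pos.le hz) (by positivity) h (u := u)
    ((mem_effDom_add_mul A.basic.plc_g₂.ne_bot A.basic.plc_f₂.ne_bot hz).2 ⟨hg, hf⟩)
  rw [A.realSum_eq h1 h2, A.realSum_eq hg hf] at h3
  exact h3

/-- Near-optimal points are almost as good as the center `x⁰`. -/
theorem nearOpt_le (A : P.Admissible prm x0 xg ε c Δ₁ D) {z : ℝ} (hz : 0 ≤ z) {x : Eucl n}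
    (h : P.NearOpt x0 ε z x) :
    P.gReal x + z * P.fReal x ≤ P.gReal x0 + z * P.fReal x0 + 1 / 2 := by
  have h1 := A.nearOpt_growth hz h A.x0_mem_g (Or.inr A.x0_mem_f)
  rw [sub_self, norm_zero] at h1
  have hε := A.eps_pos
  have h2 : 0 ≤ ε / 2 * ‖x - x0‖ ^ 2 := by positivity
  -- Completing the square: the stationarity error is worth at most `ε³ / 2`.
  have h3 : 0 ≤ ε / 2 * (‖x0 - x‖ - ε) ^ 2 := by positivity
  have h4 : ε ^ 3 ≤ 1 := pow_le_one₀ hε.le (by linarith [A.eps_le])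
  nlinarith

theorem D₀_eq (A : P.Admissible prm x0 xg ε c Δ₁ D) : P.D₀ x0 xg Δ₁ = P.gReal x0
    + max 0 (-2 * P.Dz x0 xg Δ₁ * P.fStar.toReal) + 2 * P.Dz x0 xg Δ₁ * |P.fReal xg| := by
  rw [D₀, A.u₀_eq, A.basic.g_eq A.x0_mem_g, EReal.toReal_coe]

theorem le_D₀ (A : P.Admissible prm x0 xg ε c Δ₁ D) :
    P.gReal x0 + 2 * P.Dz x0 xg Δ₁ * (P.fReal xg - P.fStar.toReal) ≤ P.D₀ x0 xg Δ₁ := by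
  rw [A.D₀_eq]
  have h1 := le_max_right 0 (-2 * P.Dz x0 xg Δ₁ * P.fStar.toReal)
  have h2 := mul_le_mul_of_nonneg_left (le_abs_self (P.fReal xg)) A.Dz_pos.le
  linarith

theorem fStar_gap (A : P.Admissible prm x0 xg ε c Δ₁ D) :
    Δ₁ ≤ P.fReal xg - P.fStar.toReal := by
  have h1 := A.fStar_le A.x0_mem_g A.x0_mem_f
  linarith [A.f_x0_lt, A.c_le]

theorem D₀_le_DL (A : P.Admissible prm x0 xg ε c Δ₁ D) : P.D₀ x0 xg Δ₁ ≤ P.DL prm.γ₁ x0 xg Δ₁ := by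
  have h1 := A.Dz_pos
  have h2 : 0 < prm.γ₁ := by linarith [A.one_lt]
  have h3 : 0 ≤ P.Lφ x0 xg Δ₁ := by unfold Lφ; positivity
  unfold DL
  have : 0 ≤ prm.γ₁ * P.Lφ x0 xg Δ₁ * P.R₁ x0 xg Δ₁ ^ 2 := by positivity
  linarith

theorem mem_levDL (A : P.Admissible prm x0 xg ε c Δ₁ D) {x : Eucl n} (hg : x ∈ effDom P.g₂)
    (h : P.gReal x ≤ P.D₀ x0 xg Δ₁) : x ∈ P.levDL prm.γ₁ x0 xg Δ₁ :=
  A.basic.mem_levSet_iff.2 ⟨hg, h.trans A.D₀_le_DL⟩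

theorem half_le_Dz_mul_gap (A : P.Admissible prm x0 xg ε c Δ₁ D) :
    1 / 2 ≤ P.Dz x0 xg Δ₁ * (P.fReal xg - P.fStar.toReal) :=
  A.half_le_Dz_mul.trans (mul_le_mul_of_nonneg_left A.fStar_gap A.Dz_pos.le)

/-- By `nearOpt_le` and `f ≥ f*`, `g(x) ≤ g(x⁰) + z (f(x⁰) - f*) + 1/2`, where `f(x⁰) ≤ f(x̃_g) -
Δ₁`. Taking `z` up to `2 D_z`, the term `2 D_z Δ₁ ≥ 1` absorbs the `1/2` and the rest is at most
`D_0`. -/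
theorem nearOpt_mem_levDL (A : P.Admissible prm x0 xg ε c Δ₁ D) {z : ℝ} (hz : 0 ≤ z)
    (hz2 : z ≤ 2 * P.Dz x0 xg Δ₁) {x : Eucl n} (h : P.NearOpt x0 ε z x) :
    x ∈ P.levDL prm.γ₁ x0 xg Δ₁ := by
  obtain ⟨h1, h2⟩ := A.nearOpt_mem hz h
  refine A.mem_levDL h1 (le_trans ?_ A.le_D₀)
  have h3 := A.nearOpt_le hz h
  have h4 : z * P.fStar.toReal ≤ z * P.fReal x := by
    rcases h2 with rfl | h2
    · simp
    · exact mul_le_mul_of_nonneg_left (A.fStar_le h1 h2) hz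
  have h5 : z * P.fReal x0 ≤ z * (P.fReal xg - Δ₁) :=
    mul_le_mul_of_nonneg_left (by linarith [A.f_x0_lt, A.c_le]) hz
  have h6 : z * (P.fReal xg - Δ₁ - P.fStar.toReal)
      ≤ 2 * P.Dz x0 xg Δ₁ * (P.fReal xg - Δ₁ - P.fStar.toReal) :=
    mul_le_mul_of_nonneg_right hz2 (by linarith [A.fStar_gap])
  linarith [A.half_le_Dz_mul]

theorem x0_mem_levDL (A : P.Admissible prm x0 xg ε c Δ₁ D) : x0 ∈ P.levDL prm.γ₁ x0 xg Δ₁ :=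
  A.mem_levDL A.x0_mem_g (le_trans (by linarith [A.half_le_Dz_mul_gap]) A.le_D₀)

theorem xg_mem_levDL (A : P.Admissible prm x0 xg ε c Δ₁ D) : xg ∈ P.levDL prm.γ₁ x0 xg Δ₁ := by
  refine A.mem_levDL A.xg_mem_g (le_trans ?_ A.le_D₀)
  linarith [A.half_le_Dz_mul_gap, A.g_xg_le A.x0_mem_g, A.eps_le]

theorem norm_sub_le (A : P.Admissible prm x0 xg ε c Δ₁ D) {x y : Eucl n}
    (hx : x ∈ P.levDL prm.γ₁ x0 xg Δ₁) (hy : y ∈ P.levDL prm.γ₁ x0 xg Δ₁) : ‖x - y‖ ≤ D := by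
  rw [← dist_eq_norm]
  exact (Metric.dist_le_diam_of_mem A.bdd.bounded_DL hx hy).trans A.Dg_le

theorem norm_gradient_le (A : P.Admissible prm x0 xg ε c Δ₁ D) {x : Eucl n}
    (hx : x ∈ P.levDL prm.γ₁ x0 xg Δ₁) :
    ‖gradient P.f₁ x‖ ≤ P.Bf prm.γ₁ x0 xg Δ₁ - P.lf₂ := by
  rw [Bf, add_sub_cancel_right]
  -- The real supremum is meaningful only for a bounded set; the Lipschitz gradient on a set of
  -- diameter at most `D` provides the bound.
  refine le_csSup ⟨‖gradient P.f₁ x0‖ + P.Lf₁ * D, ?_⟩ ⟨x, hx, rfl⟩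
  rintro _ ⟨y, hy, rfl⟩
  have h1 := A.basic.lipschitz_f₁.dist_le_mul y x0
  rw [dist_eq_norm, dist_eq_norm] at h1
  have h2 := norm_le_norm_add_norm_sub' (gradient P.f₁ y) (gradient P.f₁ x0)
  have h3 : (P.Lf₁ : ℝ) * ‖y - x0‖ ≤ P.Lf₁ * D := by
    gcongr
    exact A.norm_sub_le hy A.x0_mem_levDL
  simp only
  linarith

/-- Convexity of `f₁` uses the gradient at `x` only, so `y` need not lie in the level set. -/
theorem f_sub_le (A : P.Admissible prm x0 xg ε c Δ₁ D) {x y : Eucl n}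
    (hx : x ∈ P.levDL prm.γ₁ x0 xg Δ₁) (hxf : x ∈ effDom P.f₂) (hyf : y ∈ effDom P.f₂) :
    P.fReal x - P.fReal y ≤ P.Bf prm.γ₁ x0 xg Δ₁ * ‖x - y‖ := by
  have h1 := A.basic.convex_f₁.gradient_le (A.basic.contDiff_f₁.differentiable (by norm_num)) y x
  have h2 := A.basic.lipschitz_f₂.dist_le_mul x hxf y hyf
  rw [Real.dist_eq, dist_eq_norm] at h2
  have h3 := (abs_le.1 (abs_real_inner_le_norm (gradient P.f₁ x) (y - x))).1
  rw [norm_sub_rev y x] at h3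
  have h4 := mul_le_mul_of_nonneg_right (A.norm_gradient_le hx) (norm_nonneg (x - y))
  unfold fReal realSum
  linarith [(abs_le.1 h2).2]

theorem Bf_nonneg (A : P.Admissible prm x0 xg ε c Δ₁ D) : 0 ≤ P.Bf prm.γ₁ x0 xg Δ₁ := by
  have h1 := A.norm_gradient_le A.x0_mem_levDL
  have h2 := norm_nonneg (gradient P.f₁ x0)
  have h3 := P.lf₂.coe_nonneg
  linarith

/-- The values at `x̃_g` and `x⁰` differ by at least `Δ₁` over a distance at most `D`, so `B_f D ≥
Δ₁ ≥ ε D`. This makes the inner tolerance `ε²` no larger than `ε₂`, as stationarity in the KKT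
conditions requires. -/
theorem eps_le_Bf (A : P.Admissible prm x0 xg ε c Δ₁ D) : ε ≤ P.Bf prm.γ₁ x0 xg Δ₁ := by
  have h1 := A.f_sub_le A.xg_mem_levDL A.xg_mem_f A.x0_mem_f
  have h2 := mul_le_mul_of_nonneg_left (A.norm_sub_le A.xg_mem_levDL A.x0_mem_levDL) A.Bf_nonneg
  have h3 := A.f_x0_lt
  have h4 := A.c_le
  have h5 := A.mul_D_le
  have hD : 0 < D := by linarith [A.one_le_D]
  exact le_of_mul_le_mul_right (by linarith : ε * D ≤ _ * D) hD

theorem tol₂_nonneg (A : P.Admissible prm x0 xg ε c Δ₁ D) : 0 ≤ P.tol₂ prm.γ₁ x0 xg Δ₁ ε :=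
  mul_nonneg A.Bf_nonneg A.eps_pos.le

theorem sq_le_tol₂ (A : P.Admissible prm x0 xg ε c Δ₁ D) :
    ε ^ 2 ≤ P.tol₂ prm.γ₁ x0 xg Δ₁ ε := by
  rw [tol₂, sq]
  exact mul_le_mul_of_nonneg_right A.eps_le_Bf A.eps_pos.le

/-- By the regular condition, infeasibility of a near-optimal point bounds its multiplier. -/
theorem multiplier_le (A : P.Admissible prm x0 xg ε c Δ₁ D) {z : ℝ} (hz : 0 ≤ z)
    {x : Eucl n} (h : P.NearOpt x0 ε z x)
    (hinf : ¬ P.Feasible c (P.tol₂ prm.γ₁ x0 xg Δ₁ ε) x) : z ≤ P.Dz x0 xg Δ₁ := by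
  obtain ⟨h1, h2⟩ := A.nearOpt_mem hz h
  rcases h2 with rfl | h2
  · exact A.Dz_pos.le
  have h3 : P.tol₂ prm.γ₁ x0 xg Δ₁ ε < P.fReal x - c := by
    by_contra! hcon
    exact hinf ⟨h2, hcon⟩
  have h4 := A.nearOpt_le hz h
  have h5 : 0 ≤ z * (P.fReal x - c) := mul_nonneg hz (by linarith [A.tol₂_nonneg])
  have h6 : z * (P.fReal x0 - c) ≤ z * (-Δ₁) := mul_le_mul_of_nonneg_left A.f_x0_lt.le hz
  -- Infeasibility makes `z f_c(x)` nonnegative, so `z Δ₁ ≤ g(x⁰) - g(x) + 1/2`; the remaining half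
  -- in `D_z` covers `g(x̃_g) ≤ g(x) + ε`.
  refine le_of_mul_le_mul_right (?_ : z * Δ₁ ≤ _ * Δ₁) A.gap_pos
  rw [A.Dz_mul]
  linarith [A.g_xg_le h1, A.eps_le]

/-- The lower end of a bracket: either `0`, or a multiplier with an infeasible near-optimal
point. -/
def LowerEnd (P : Bilevel n) (x0 : Eucl n) (ε c ε₂ a : ℝ) : Prop :=
  a = 0 ∨ (0 < a ∧ ∃ xa, P.NearOpt x0 ε a xa ∧ ¬ P.Feasible c ε₂ xa)

/-- Feasibility bounds `f_c(xb)` from above; only a lower bound is at stake. If `a = 0` was never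
tested, smallness of `b ≤ ε²` compensates for a crude one; otherwise the infeasible point at `a` is
close to `xb`. -/
theorem abs_mul_fc_le (A : P.Admissible prm x0 xg ε c Δ₁ D) {a b : ℝ} {xb : Eucl n}
    (ha : 0 ≤ a) (hab : a ≤ b) (hb : b ≤ 2 * P.Dz x0 xg Δ₁) (hsmall : b - a ≤ ε ^ 2)
    (hxb : P.NearOpt x0 ε b xb) (hfeas : P.Feasible c (P.tol₂ prm.γ₁ x0 xg Δ₁ ε) xb)
    (hlow : LowerEnd P x0 ε c (P.tol₂ prm.γ₁ x0 xg Δ₁ ε) a) :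
    ((b : EReal) * P.fc c xb).abs ≤ ENNReal.ofReal (P.tol₃ prm.γ₁ x0 xg Δ₁ ε) := by
  have hε := A.eps_pos
  have hB := A.Bf_nonneg
  have hDz := A.Dz_pos
  have hb0 : 0 ≤ b := ha.trans hab
  have hxbL := A.nearOpt_mem_levDL hb0 hb hxb
  have hup : P.fReal xb - c ≤ P.Bf prm.γ₁ x0 xg Δ₁ * ε := hfeas.2
  rw [A.basic.fc_eq hfeas.1, ← EReal.coe_mul, EReal.abs_def]
  refine ENNReal.ofReal_le_ofReal ?_
  rw [abs_mul, abs_of_nonneg hb0]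
  rcases hlow with rfl | ⟨ha0, xa, hxa, hinf⟩
  · have hlo := A.f_sub_le A.xg_mem_levDL A.xg_mem_f hfeas.1
    have hdist := mul_le_mul_of_nonneg_left (A.norm_sub_le A.xg_mem_levDL hxbL) hB
    have hBD : P.Bf prm.γ₁ x0 xg Δ₁ * ε ≤ P.Bf prm.γ₁ x0 xg Δ₁ * D := by
      gcongr; linarith [A.eps_le, A.one_le_D]
    have habs : |P.fReal xb - c| ≤ P.Bf prm.γ₁ x0 xg Δ₁ * D := by
      rw [abs_le]; constructor <;> linarith [A.c_le]
    have hεD : ε * D ≤ 2 * P.Dz x0 xg Δ₁ := by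
      refine le_of_mul_le_mul_right (?_ : ε * D * Δ₁ ≤ _ * Δ₁) A.gap_pos
      linarith [A.mul_D_mul_le, A.half_le_Dz_mul]
    calc b * |P.fReal xb - c| ≤ ε ^ 2 * (P.Bf prm.γ₁ x0 xg Δ₁ * D) := by
          gcongr; linarith
      _ = ε * D * (P.Bf prm.γ₁ x0 xg Δ₁ * ε) := by ring
      _ ≤ 2 * P.Dz x0 xg Δ₁ * (P.Bf prm.γ₁ x0 xg Δ₁ * ε) := by gcongr
      _ ≤ 2 * P.Dz x0 xg Δ₁ * (P.Bf prm.γ₁ x0 xg Δ₁ * ε)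
          + 2 * P.Dz x0 xg Δ₁ * P.Bf prm.γ₁ x0 xg Δ₁ ^ 2 * ε :=
          le_add_of_nonneg_right (by positivity)
      _ = P.tol₃ prm.γ₁ x0 xg Δ₁ ε := by unfold tol₃; ring
  · have hxaL := A.nearOpt_mem_levDL ha (hab.trans hb) hxa
    obtain ⟨hag, haf⟩ := A.nearOpt_mem ha hxa
    obtain ⟨hbg, -⟩ := A.nearOpt_mem hb0 hxb
    have haf' : xa ∈ effDom P.f₂ := haf.resolve_left ha0.ne'
    have hlow : P.Bf prm.γ₁ x0 xg Δ₁ * ε < P.fReal xa - c := by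
      by_contra! hcon
      exact hinf ⟨haf', hcon⟩
    have g1 := A.nearOpt_growth ha hxa hbg (Or.inr hfeas.1)
    have g2 := A.nearOpt_growth hb0 hxb hag (Or.inr haf')
    have hlip := A.f_sub_le hxaL haf' hfeas.1
    rw [norm_sub_rev xb xa] at g1
    set d := ‖xa - xb‖ with hd
    have hd0 : 0 ≤ d := norm_nonneg _
    -- Test each point in the growth inequality of the other and add: everything cancels except `(b
    -- - a)(f(xa) - f(xb))` and the errors.
    have hkey : ε * d ^ 2 ≤ 2 * ε ^ 2 * d + ε ^ 2 * (P.Bf prm.γ₁ x0 xg Δ₁ * d) := by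
      have : (b - a) * (P.fReal xa - P.fReal xb) ≤ ε ^ 2 * (P.Bf prm.γ₁ x0 xg Δ₁ * d) := by
        refine (mul_le_mul_of_nonneg_left hlip (by linarith)).trans ?_
        gcongr
      linarith
    have hdle : d ≤ ε * (2 + P.Bf prm.γ₁ x0 xg Δ₁) := by
      by_contra! hcon
      have hdp : 0 < d := lt_of_le_of_lt (by positivity) hcon
      have : ε * d * (ε * (2 + P.Bf prm.γ₁ x0 xg Δ₁)) < ε * d * d :=
        mul_lt_mul_of_pos_left hcon (by positivity)
      linarith
    have hBd := mul_le_mul_of_nonneg_left hdle hB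
    -- From `f(xa) > c + B_f ε` and `f(xa) - f(xb) ≤ B_f (2 + B_f) ε`; the excess at `xa` cancels
    -- one of the two `B_f ε`, leaving exactly the constant of `ε₃`.
    have habs : |P.fReal xb - c|
        ≤ (P.Bf prm.γ₁ x0 xg Δ₁ + P.Bf prm.γ₁ x0 xg Δ₁ ^ 2) * ε := by
      have : 0 ≤ P.Bf prm.γ₁ x0 xg Δ₁ ^ 2 * ε := by positivity
      rw [abs_le]; constructor <;> linarith
    calc b * |P.fReal xb - c| ≤ 2 * P.Dz x0 xg Δ₁
          * ((P.Bf prm.γ₁ x0 xg Δ₁ + P.Bf prm.γ₁ x0 xg Δ₁ ^ 2) * ε) := by gcongr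
      _ = P.tol₃ prm.γ₁ x0 xg Δ₁ ε := by unfold tol₃; ring

theorem kktConditions (A : P.Admissible prm x0 xg ε c Δ₁ D) {z : ℝ} (hz : 0 ≤ z) {x : Eucl n}
    (h : P.NearOpt x0 ε z x) (hfeas : P.Feasible c (P.tol₂ prm.γ₁ x0 xg Δ₁ ε) x)
    (hcs : ((z : EReal) * P.fc c x).abs ≤ ENNReal.ofReal (P.tol₃ prm.γ₁ x0 xg Δ₁ ε)) :
    P.KKTConditions x0 ε c
      (max (P.tol₂ prm.γ₁ x0 xg Δ₁ ε) (P.tol₃ prm.γ₁ x0 xg Δ₁ ε)) x z := by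
  refine ⟨hz, ?_, ?_, hcs.trans (ENNReal.ofReal_le_ofReal (le_max_right _ _))⟩
  · exact (h.nearStationary_lagr A.basic ⟨x0, A.x0_mem_g, A.x0_mem_f⟩ hz c).mono
      (A.sq_le_tol₂.trans (le_max_left _ _))
  · refine ((A.basic.feasible_iff A.tol₂_nonneg).2 hfeas).trans ?_
    exact_mod_cast le_max_left _ _

end Admissible

/-! ### The calls of the inner method -/

/-- The bound on the accepted trial values in the calls of the inner method. -/
def trialBound (P : Bilevel n) (prm : APGParams) (x0 xg : Eucl n) (Δ₁ : ℝ) : ℝ :=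
  max prm.Lmin (prm.γ₁ * P.Lφ x0 xg Δ₁)

/-- The bound on the number of oracle queries in a call of the inner method. -/
def callCost (P : Bilevel n) (prm : APGParams) (x0 xg : Eucl n) (Δ₁ ε : ℝ) : ℝ :=
  APGSetting.costC prm * √(P.trialBound prm x0 xg Δ₁ / ε) * (1 + 5 * |Real.log ε|)

namespace Admissible

variable {prm : APGParams} {x0 xg : Eucl n} {ε c Δ₁ D : ℝ}

/-- The exact minimizer is in particular ε²-stationary, so it lies in the level set too; this bounds
its distance to any admissible starting point. -/
theorem exists_apgSetting (A : P.Admissible prm x0 xg ε c Δ₁ D) {z : ℝ} (hz : 0 ≤ z)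
    (hz2 : z ≤ 2 * P.Dz x0 xg Δ₁) : ∃ xs, xs ∈ P.levDL prm.γ₁ x0 xg Δ₁ ∧
      APGSetting (fun x => P.gEps x0 ε x + z * P.f₁ x) (fun x => P.g₂ x + (z : EReal) * P.f₂ x)
        prm ε (P.Lφ x0 xg Δ₁) (P.trialBound prm x0 xg Δ₁) xs := by
  have hplc := A.plc hz
  have hDz := A.Dz_pos
  have hsm := A.basic.smoothStrong x0 A.eps_pos.le hz
  have hL : (P.Lg₁ : ℝ) + ε + z * P.Lf₁ ≤ P.Lφ x0 xg Δ₁ := by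
    have : z * P.Lf₁ ≤ 2 * P.Dz x0 xg Δ₁ * P.Lf₁ := by gcongr
    unfold Lφ
    linarith [A.eps_le]
  obtain ⟨xs, h1, h2⟩ := exists_minimizer hplc A.eps_pos hsm
  have hopt : P.NearOpt x0 ε z xs :=
    nearStationary_of_mem (v := 0) ((mem_subdiff_add_iff hplc).2 ⟨h1, fun u hu => by
      simpa using h2 u hu⟩) (by rw [norm_zero]; positivity)
  exact ⟨xs, A.nearOpt_mem_levDL hz hz2 hopt,
    { plc := hplc
      smooth := hsm.mono hL
      Lmin_pos := A.Lmin_pos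
      one_lt := A.one_lt
      one_le := A.one_le
      mu_pos := A.eps_pos
      mu_le := A.four_mul_le
      L_nonneg := by unfold Lφ; positivity
      Lmin_le := le_max_left _ _
      mul_le := le_max_right _ _
      xs_mem := h1
      xs_min := h2 }⟩

/-- Replacing `D_z` by its bound `D` makes the smallness condition on `ε` independent of the points
`x⁰`, `x̃_g`. -/
theorem trialBound_small (A : P.Admissible prm x0 xg ε c Δ₁ D) :
    4 * (P.trialBound prm x0 xg Δ₁) ^ 3 * D ^ 2 * ε ≤ prm.Lmin := by
  refine le_trans ?_ A.energy_small
  have h0 := A.Lmin_pos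
  have h1 := A.one_lt
  have h2 := A.eps_pos
  have h3 := A.Dz_le
  have h4 : 0 ≤ P.trialBound prm x0 xg Δ₁ := h0.le.trans (le_max_left _ _)
  have h5 : P.trialBound prm x0 xg Δ₁
      ≤ max prm.Lmin (prm.γ₁ * (P.Lg₁ + 2 * D * P.Lf₁ + 1)) := by
    unfold trialBound Lφ
    gcongr
  gcongr

theorem exists_subAPG (A : P.Admissible prm x0 xg ε c Δ₁ D) {z : ℝ} (hz : 0 ≤ z)
    (hz2 : z ≤ 2 * P.Dz x0 xg Δ₁) (y₀ : Eucl n) :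
    ∃ xout N, P.SubAPG prm x0 ε (tol₁ ε) z y₀ xout N := by
  obtain ⟨xs, -, S⟩ := A.exists_apgSetting hz hz2
  exact S.exists_run (pow_pos A.eps_pos 2) y₀

theorem subAPG (A : P.Admissible prm x0 xg ε c Δ₁ D) {z : ℝ} (hz : 0 ≤ z)
    (hz2 : z ≤ 2 * P.Dz x0 xg Δ₁) {y₀ xout : Eucl n} (hy : y₀ ∈ P.levDL prm.γ₁ x0 xg Δ₁) {N : ℕ}
    (hrun : P.SubAPG prm x0 ε (tol₁ ε) z y₀ xout N) :
    P.NearOpt x0 ε z xout ∧ xout ∈ P.levDL prm.γ₁ x0 xg Δ₁ ∧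
      (N : ℝ) ≤ P.callCost prm x0 xg Δ₁ ε := by
  obtain ⟨xs, hxs, S⟩ := A.exists_apgSetting hz hz2
  have hε := A.eps_pos
  have hM := S.M_pos
  have hlog : Real.log ε ≤ 0 := Real.log_nonpos hε.le (by linarith [A.eps_le])
  have hexp : Real.exp (5 * |Real.log ε|) = (ε ^ 5)⁻¹ := by
    rw [abs_of_nonpos hlog, ← Real.exp_log (pow_pos hε 5), ← Real.exp_neg, Real.log_pow]
    congr 1
    push_cast
    ring
  -- With `δ = ε²` the threshold is of order `ε⁴`; the fifth power of `1/ε` leaves one factor `ε` to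
  -- beat the constant `4 M³ D² / Lmin`.
  obtain ⟨h1, h2⟩ := S.cost (Λ := 5 * |Real.log ε|) (pow_pos hε 2) hrun (A.norm_sub_le hxs hy)
    (by positivity) (by
      rw [hexp, stopLevel]
      have h := A.trialBound_small
      rw [← div_eq_mul_inv, div_div, le_div_iff₀ (by positivity)]
      have h' := mul_le_mul_of_nonneg_left h (by positivity : 0 ≤ ε ^ 4)
      linarith)
  exact ⟨h1, A.nearOpt_mem_levDL hz hz2 h1, h2⟩

/-! ### The interval search -/

/-- The body runs only for `b ≤ D_z`, so every call has a multiplier at most `2 D_z`, and doubling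
exceeds `D_z` eventually. -/
theorem exists_intVLoop (A : P.Admissible prm x0 xg ε c Δ₁ D) {a b : ℝ} (x : Eucl n) (hb : 0 < b) :
    ∃ a' b' xb, P.IntVLoop prm x0 ε c (P.Dz x0 xg Δ₁) (tol₁ ε) (P.tol₂ prm.γ₁ x0 xg Δ₁ ε)
      a b x a' b' xb := by
  obtain ⟨j, hj⟩ := pow_unbounded_of_one_lt (P.Dz x0 xg Δ₁ / b) (one_lt_two (α := ℝ))
  have hj' : P.Dz x0 xg Δ₁ < 2 ^ j * b := (div_lt_iff₀ hb).1 hj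
  clear hj
  induction j generalizing a b x with
  | zero => exact ⟨a, b, x, .exit a b x fun h => by linarith [h.2]⟩
  | succ j ih =>
    by_cases h : ((P.tol₂ prm.γ₁ x0 xg Δ₁ ε : ℝ) : EReal) < max (P.fc c x) 0 ∧ b ≤ P.Dz x0 xg Δ₁
    · obtain ⟨x', N, hrun⟩ := A.exists_subAPG (z := 2 * b) (by linarith) (by linarith [h.2]) x
      obtain ⟨a', b', xb, hrest⟩ := ih (a := b) (b := 2 * b) x' (by linarith)
        (by rw [pow_succ] at hj'; linarith)
      exact ⟨a', b', xb, .step a b x x' N a' b' xb h hrun hrest⟩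
    · exact ⟨a, b, x, .exit a b x h⟩

theorem exists_runIntV (A : P.Admissible prm x0 xg ε c Δ₁ D) {σ : ℝ} (w : Eucl n) (hσ : 0 < σ)
    (hσ2 : σ ≤ 2 * P.Dz x0 xg Δ₁) : ∃ a b xb, P.RunIntV prm x0 xg ε c Δ₁ σ w a b xb := by
  obtain ⟨x, N, h0⟩ := A.exists_subAPG le_rfl (hσ.le.trans hσ2) w
  by_cases hf : max (P.fc c x) 0 ≤ ((P.tol₂ prm.γ₁ x0 xg Δ₁ ε : ℝ) : EReal)
  · exact ⟨0, 0, x, .zero x N h0 hf⟩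
  obtain ⟨x', N', h1⟩ := A.exists_subAPG hσ.le hσ2 x
  obtain ⟨a, b, xb, hl⟩ := A.exists_intVLoop (a := 0) x' hσ
  by_cases hcs : ((b : EReal) * P.fc c xb).abs ≤ ENNReal.ofReal (P.tol₃ prm.γ₁ x0 xg Δ₁ ε)
  · exact ⟨b, b, xb, .singleton x x' N N' a b xb h0 hf h1 hl hcs⟩
  · exact ⟨a, b, xb, .interval x x' N N' a b xb h0 hf h1 hl hcs⟩

/-- The invariant of both procedures: `[a, b]` is a bracket with the point `xb` for `b`, apart
from complementary slackness. -/
structure Bracket (P : Bilevel n) (prm : APGParams) (x0 xg : Eucl n) (ε c Δ₁ a b : ℝ)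
    (xb : Eucl n) : Prop where
  nonneg : 0 ≤ a
  le : a ≤ b
  le_Dz : b ≤ 2 * P.Dz x0 xg Δ₁
  nearOpt : P.NearOpt x0 ε b xb
  feasible : P.Feasible c (P.tol₂ prm.γ₁ x0 xg Δ₁ ε) xb

theorem intVLoop (A : P.Admissible prm x0 xg ε c Δ₁ D) {a b a' b' : ℝ} {x xb : Eucl n}
    (hrun : P.IntVLoop prm x0 ε c (P.Dz x0 xg Δ₁) (tol₁ ε) (P.tol₂ prm.γ₁ x0 xg Δ₁ ε)
      a b x a' b' xb) (ha : 0 ≤ a) (hab : a < b) (hb : b ≤ 2 * P.Dz x0 xg Δ₁)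
    (hx : P.NearOpt x0 ε b x)
    (hlow : LowerEnd P x0 ε c (P.tol₂ prm.γ₁ x0 xg Δ₁ ε) a) :
    Bracket P prm x0 xg ε c Δ₁ a' b' xb ∧
      LowerEnd P x0 ε c (P.tol₂ prm.γ₁ x0 xg Δ₁ ε) a' := by
  induction hrun with
  | exit a b x h =>
    refine ⟨⟨ha, hab.le, hb, hx, ?_⟩, hlow⟩
    -- An infeasible exit would have `b > D_z`, which `multiplier_le` excludes.
    by_contra hcon
    refine h ⟨not_le.1 fun hle => hcon ((A.basic.feasible_iff A.tol₂_nonneg).1 hle), ?_⟩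
    exact A.multiplier_le (ha.trans hab.le) hx hcon
  | step a b x x' N a' b' xout h hcall hrest ih =>
    have hb0 : 0 < b := ha.trans_lt hab
    have hxL := A.nearOpt_mem_levDL hb0.le hb hx
    obtain ⟨h1, -, -⟩ := A.subAPG (z := 2 * b) (by linarith) (by linarith [h.2]) hxL hcall
    refine ih hb0.le (by linarith) (by linarith [h.2]) h1 (Or.inr ⟨hb0, x, hx, fun hcon => ?_⟩)
    exact absurd ((A.basic.feasible_iff A.tol₂_nonneg).2 hcon) (not_le.2 h.1)

/-- A singleton output has no infeasible point at its left end; it carries complementary slackness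
instead, hence the alternative. -/
theorem runIntV (A : P.Admissible prm x0 xg ε c Δ₁ D) {σ a b : ℝ} {w xb : Eucl n} (hσ : 0 < σ)
    (hσ2 : σ ≤ 2 * P.Dz x0 xg Δ₁) (hw : w ∈ P.levDL prm.γ₁ x0 xg Δ₁)
    (hrun : P.RunIntV prm x0 xg ε c Δ₁ σ w a b xb) :
    Bracket P prm x0 xg ε c Δ₁ a b xb ∧
      (LowerEnd P x0 ε c (P.tol₂ prm.γ₁ x0 xg Δ₁ ε) a ∨ (a = b ∧
        ((b : EReal) * P.fc c xb).abs ≤ ENNReal.ofReal (P.tol₃ prm.γ₁ x0 xg Δ₁ ε))) := by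
  have hDz := A.Dz_pos
  cases hrun with
  | zero _ N hcall h =>
    obtain ⟨h1, -, -⟩ := A.subAPG le_rfl (by positivity) hw hcall
    exact ⟨⟨le_rfl, le_rfl, by positivity, h1, (A.basic.feasible_iff A.tol₂_nonneg).1 h⟩,
      Or.inl (Or.inl rfl)⟩
  | singleton x x' N N' a _ _ hcall h hcall' hloop hb =>
    obtain ⟨-, h1, -⟩ := A.subAPG le_rfl (by positivity) hw hcall
    obtain ⟨h2, -, -⟩ := A.subAPG hσ.le hσ2 h1 hcall'
    obtain ⟨h3, -⟩ := A.intVLoop hloop le_rfl hσ hσ2 h2 (Or.inl rfl)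
    exact ⟨⟨h3.nonneg.trans h3.le, le_rfl, h3.le_Dz, h3.nearOpt, h3.feasible⟩,
      Or.inr ⟨rfl, hb⟩⟩
  | interval x x' N N' _ _ _ hcall h hcall' hloop hb =>
    obtain ⟨-, h1, -⟩ := A.subAPG le_rfl (by positivity) hw hcall
    obtain ⟨h2, -, -⟩ := A.subAPG hσ.le hσ2 h1 hcall'
    obtain ⟨h3, h4⟩ := A.intVLoop hloop le_rfl hσ hσ2 h2 (Or.inl rfl)
    exact ⟨h3, Or.inl h4⟩

theorem withValue (A : P.Admissible prm x0 xg ε c Δ₁ D) {c' : ℝ}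
    (h : P.RegularCondition x0 xg ε c' Δ₁) : P.Admissible prm x0 xg ε c' Δ₁ D :=
  { A with reg := h }

theorem bisecInput (A : P.Admissible prm x0 xg ε c Δ₁ D) {a b : ℝ} {xb : Eucl n}
    (h : P.BisecInput prm x0 xg ε c Δ₁ a b xb) :
    Bracket P prm x0 xg ε c Δ₁ a b xb ∧
      (LowerEnd P x0 ε c (P.tol₂ prm.γ₁ x0 xg Δ₁ ε) a ∨ (a = b ∧
        ((b : EReal) * P.fc c xb).abs ≤ ENNReal.ofReal (P.tol₃ prm.γ₁ x0 xg Δ₁ ε))) := by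
  obtain ⟨σ, w, hσ, hσ2, hw, hrun | ⟨rfl, c', a', hc, hreg, hrun⟩⟩ := h
  · exact A.runIntV hσ hσ2 hw hrun
  · obtain ⟨h1, -⟩ := (A.withValue hreg).runIntV hσ hσ2 hw hrun
    exact ⟨⟨le_rfl, h1.nonneg.trans h1.le, h1.le_Dz, h1.nearOpt, h1.feasible.1,
      (by linarith [h1.feasible.2])⟩, Or.inl (Or.inl rfl)⟩

/-! ### The dual bisection -/

theorem exists_runBisec (A : P.Admissible prm x0 xg ε c Δ₁ D) {a b : ℝ} (xb w : Eucl n)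
    (ha : 0 ≤ a) (hab : a ≤ b) (hb : b ≤ 2 * P.Dz x0 xg Δ₁) :
    ∃ x z N, P.RunBisec prm x0 xg ε c Δ₁ a b xb w x z N := by
  have hε := A.eps_pos
  obtain ⟨j, hj⟩ := pow_unbounded_of_one_lt ((b - a) / ε ^ 2) (one_lt_two (α := ℝ))
  have hj' : b - a ≤ 2 ^ j * ε ^ 2 := ((div_lt_iff₀ (by positivity)).1 hj).le
  clear hj
  induction j generalizing a b xb w with
  | zero =>
    refine ⟨xb, b, 0, .ended a b xb w ?_⟩
    rw [tol₁]
    linarith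
  | succ j ih =>
    by_cases h : tol₁ ε < b - a
    · obtain ⟨x', N, hcall⟩ := A.exists_subAPG (z := (a + b) / 2) (by linarith) (by linarith) w
      rw [pow_succ] at hj'
      by_cases hf : max (P.fc c x') 0 ≤ ((P.tol₂ prm.γ₁ x0 xg Δ₁ ε : ℝ) : EReal)
      · by_cases hcs : ((((a + b) / 2 : ℝ) : EReal) * P.fc c x').abs
            ≤ ENNReal.ofReal (P.tol₃ prm.γ₁ x0 xg Δ₁ ε)
        · exact ⟨x', _, _, .found a b xb w x' N h hcall hf hcs⟩
        · obtain ⟨x, z, N', hrest⟩ := ih (a := a) (b := (a + b) / 2) x' x' ha (by linarith)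
            (by linarith) (by linarith)
          exact ⟨x, z, _, .right a b xb w x' N x z N' h hcall hf hcs hrest⟩
      · obtain ⟨x, z, N', hrest⟩ := ih (a := (a + b) / 2) (b := b) xb x' (by linarith)
          (by linarith) hb (by linarith)
        exact ⟨x, z, _, .left a b xb w x' N x z N' h hcall (not_le.1 hf) hrest⟩
    · exact ⟨xb, b, 0, .ended a b xb w h⟩

/-- Halving lowers `1 + log₂((b - a)/η)` by one, which pays for one call; truncation at zero covers
intervals already short enough. -/
theorem bisection_cost {T η a b N N' : ℝ} (hη : 0 < η) (h : η < b - a) (hN : N ≤ T)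
    (hN' : N' ≤ T * max 0 (1 + Real.log ((b - a) / 2 / η) / Real.log 2)) :
    N + N' ≤ T * max 0 (1 + Real.log ((b - a) / η) / Real.log 2) := by
  have hba : 0 < b - a := hη.trans h
  have h2 : 0 < Real.log 2 := Real.log_pos one_lt_two
  have h1 : 0 < Real.log ((b - a) / η) := Real.log_pos ((one_lt_div hη).2 h)
  have e : Real.log ((b - a) / 2 / η) = Real.log ((b - a) / η) - Real.log 2 := by
    rw [← Real.log_div (by positivity) (by norm_num)]
    congr 1
    field_simp
  have e2 : 1 + Real.log ((b - a) / 2 / η) / Real.log 2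
      = Real.log ((b - a) / η) / Real.log 2 := by
    rw [e]; field_simp; ring
  rw [e2, max_eq_right (by positivity)] at hN'
  rw [max_eq_right (by positivity)]
  linarith

/-- The right endpoint always keeps a feasible near-optimal point, and the left one is `0` or
carries an infeasible one. Early return checks slackness directly; exhaustion obtains it from
`abs_mul_fc_le` or from the singleton. -/
theorem runBisec (A : P.Admissible prm x0 xg ε c Δ₁ D) {a b : ℝ} {xb w x : Eucl n} {z : ℝ} {N : ℕ}
    (hrun : P.RunBisec prm x0 xg ε c Δ₁ a b xb w x z N)
    (hbr : Bracket P prm x0 xg ε c Δ₁ a b xb)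
    (hlow : LowerEnd P x0 ε c (P.tol₂ prm.γ₁ x0 xg Δ₁ ε) a ∨ (a = b ∧
      ((b : EReal) * P.fc c xb).abs ≤ ENNReal.ofReal (P.tol₃ prm.γ₁ x0 xg Δ₁ ε)))
    (hw : w ∈ P.levDL prm.γ₁ x0 xg Δ₁) :
    P.KKTConditions x0 ε c
      (max (P.tol₂ prm.γ₁ x0 xg Δ₁ ε) (P.tol₃ prm.γ₁ x0 xg Δ₁ ε)) x z ∧
    (N : ℝ) ≤ (P.callCost prm x0 xg Δ₁ ε + 2)
      * max 0 (1 + Real.log ((b - a) / tol₁ ε) / Real.log 2) := by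
  have hη : 0 < tol₁ ε := pow_pos A.eps_pos 2
  unfold RunBisec at hrun
  induction hrun with
  | ended a b xb w h =>
    have hT : 0 ≤ P.callCost prm x0 xg Δ₁ ε := by
      obtain ⟨x', N, hcall⟩ := A.exists_subAPG (hbr.nonneg.trans hbr.le) hbr.le_Dz w
      exact (Nat.cast_nonneg N).trans
        (A.subAPG (hbr.nonneg.trans hbr.le) hbr.le_Dz hw hcall).2.2
    refine ⟨A.kktConditions (hbr.nonneg.trans hbr.le) hbr.nearOpt hbr.feasible ?_, ?_⟩
    · rcases hlow with hlow | ⟨-, hcs⟩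
      · exact A.abs_mul_fc_le hbr.nonneg hbr.le hbr.le_Dz (not_lt.1 h) hbr.nearOpt hbr.feasible
          hlow
      · exact hcs
    · rw [Nat.cast_zero]
      exact mul_nonneg (by linarith) (le_max_left _ _)
  | left a b xb w x' N xout zout N' h hcall hpos hrest ih =>
    have ha := hbr.nonneg
    have hb := hbr.le_Dz
    obtain ⟨h1, h2, h3⟩ := A.subAPG (z := (a + b) / 2) (by linarith) (by linarith) hw hcall
    obtain ⟨h4, h5⟩ := ih ⟨by linarith, by linarith, hb, hbr.nearOpt, hbr.feasible⟩
      (Or.inl (Or.inr ⟨by linarith, x', h1, fun hcon =>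
        absurd ((A.basic.feasible_iff A.tol₂_nonneg).2 hcon) (not_le.2 hpos)⟩)) h2
    refine ⟨h4, ?_⟩
    push_cast
    have e : b - (a + b) / 2 = (b - a) / 2 := by ring
    rw [e] at h5
    exact bisection_cost hη h (by linarith) h5
  | found a b xb w x' N h hcall hpos hcs =>
    have ha := hbr.nonneg
    have hb := hbr.le_Dz
    obtain ⟨h1, h2, h3⟩ := A.subAPG (z := (a + b) / 2) (by linarith) (by linarith) hw hcall
    refine ⟨A.kktConditions (by linarith) h1 ((A.basic.feasible_iff A.tol₂_nonneg).1 hpos) hcs, ?_⟩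
    have hT : 0 ≤ P.callCost prm x0 xg Δ₁ ε + 2 := by
      linarith [(Nat.cast_nonneg N : (0 : ℝ) ≤ N)]
    have h5 := bisection_cost (N := N + 2) (N' := 0) hη h (by linarith)
      (mul_nonneg hT (le_max_left _ _))
    push_cast
    linarith
  | right a b xb w x' N xout zout N' h hcall hpos hcs hrest ih =>
    have ha := hbr.nonneg
    have hb := hbr.le_Dz
    obtain ⟨h1, h2, h3⟩ := A.subAPG (z := (a + b) / 2) (by linarith) (by linarith) hw hcall
    -- The singleton alternative is impossible here, because the loop runs only on intervals of
    -- positive length.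
    obtain ⟨h4, h5⟩ := ih
      ⟨ha, by linarith, by linarith, h1, (A.basic.feasible_iff A.tol₂_nonneg).1 hpos⟩
      (Or.inl (hlow.resolve_right fun hab => by linarith [hab.1])) h2
    refine ⟨h4, ?_⟩
    push_cast
    have e : (a + b) / 2 - a = (b - a) / 2 := by ring
    rw [e] at h5
    exact bisection_cost hη h (by linarith) h5

/-- The total number of oracle queries, with an explicit constant. -/
theorem totalCost_le (A : P.Admissible prm x0 xg ε c Δ₁ D) {a b : ℝ} (ha : 0 ≤ a) (hab : a ≤ b)
    (hb : b ≤ 2 * P.Dz x0 xg Δ₁) :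
    (P.callCost prm x0 xg Δ₁ ε + 2) * max 0 (1 + Real.log ((b - a) / tol₁ ε) / Real.log 2)
      ≤ 7 * (6 * APGSetting.costC prm + 2) * √(prm.Lmin + prm.γ₁)
        * √((P.Lg₁ + 2 * P.Dz x0 xg Δ₁ * P.Lf₁ + 1) / ε) * |Real.log ε| ^ 2 := by
  have hε := A.eps_pos
  have hDz := A.Dz_pos
  have hl := A.Lmin_pos
  have hγ := A.one_lt
  have hlogγ : 0 < Real.log prm.γ₁ := Real.log_pos hγ
  have hC : 0 ≤ APGSetting.costC prm := by
    unfold APGSetting.costC APGSetting.costB APGSetting.costA; positivity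
  have hlog1 : Real.log ε ≤ -1 := by
    rw [Real.log_le_iff_le_exp hε]
    linarith [A.eps_le, Real.exp_neg_one_gt_d9]
  set ℓ := |Real.log ε| with hℓ
  have hℓe : ℓ = -Real.log ε := abs_of_nonpos (by linarith)
  have hℓ1 : 1 ≤ ℓ := by linarith
  have hLφ : 1 ≤ P.Lφ x0 xg Δ₁ := by
    have : 0 ≤ (P.Lg₁ : ℝ) + 2 * P.Dz x0 xg Δ₁ * P.Lf₁ := by positivity
    unfold Lφ; linarith
  set M := P.trialBound prm x0 xg Δ₁ with hM
  have hMl : prm.Lmin ≤ M := le_max_left _ _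
  -- As `L_φ ≥ 1`, the minimum trial value is absorbed into a multiple of `L_φ`, so the constant
  -- depends on the parameters alone.
  have hMle : M ≤ (prm.Lmin + prm.γ₁) * P.Lφ x0 xg Δ₁ := by
    refine max_le ?_ ?_
    · nlinarith
    · nlinarith
  have hR1 : 1 ≤ √(M / ε) := by
    rw [Real.one_le_sqrt, one_le_div hε]
    linarith [A.four_mul_le]
  have hRle : √(M / ε) ≤ √(prm.Lmin + prm.γ₁) * √(P.Lφ x0 xg Δ₁ / ε) := by
    rw [← Real.sqrt_mul (by linarith)]
    refine Real.sqrt_le_sqrt ?_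
    rw [← mul_div_assoc]
    gcongr
  have hT : P.callCost prm x0 xg Δ₁ ε + 2 ≤ (6 * APGSetting.costC prm + 2) * √(M / ε) * ℓ := by
    have h1 : APGSetting.costC prm * √(M / ε) * (1 + 5 * ℓ)
        ≤ APGSetting.costC prm * √(M / ε) * (6 * ℓ) := by gcongr; linarith
    have h2 : 1 ≤ √(M / ε) * ℓ := one_le_mul_of_one_le_of_one_le hR1 hℓ1
    unfold callCost
    rw [← hM, ← hℓ]
    linarith
  -- The length is at most `2 D ≤ 1/ε`, so the ratio is at most `ε⁻³`; with `1 / log 2 ≤ 2` and `1 ≤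
  -- ℓ` this gives `6 ℓ + ℓ`.
  have hsteps : max 0 (1 + Real.log ((b - a) / tol₁ ε) / Real.log 2) ≤ 7 * ℓ := by
    refine max_le (by linarith) ?_
    have h1 : Real.log ((b - a) / tol₁ ε) ≤ 3 * ℓ := by
      rcases (sub_nonneg.2 hab).eq_or_lt with h0 | h0
      -- A degenerate interval uses the convention `log 0 = 0`.
      · rw [← h0, zero_div, Real.log_zero]; linarith
      · have h2 : (b - a) / tol₁ ε ≤ ε⁻¹ ^ 3 := by
          have : b - a ≤ 1 / ε := by
            rw [le_div_iff₀ hε]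
            have := mul_le_mul_of_nonneg_right (by linarith [A.Dz_le] : b - a ≤ 2 * D) hε.le
            linarith [A.two_mul_le]
          rw [tol₁, div_le_iff₀ (by positivity)]
          refine this.trans_eq ?_
          field_simp
        have h3 := Real.log_le_log (by unfold tol₁; positivity) h2
        rw [Real.log_pow, Real.log_inv] at h3
        rw [hℓe]
        push_cast at h3
        linarith
    have h2 := Real.log_two_gt_d9
    have h3 : Real.log ((b - a) / tol₁ ε) / Real.log 2 ≤ 6 * ℓ := by
      rw [div_le_iff₀ (by linarith)]
      nlinarith
    linarith
  calc _ ≤ (6 * APGSetting.costC prm + 2) * √(M / ε) * ℓ * (7 * ℓ) := by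
        refine mul_le_mul hT hsteps (le_max_left _ _) (by positivity)
    _ ≤ (6 * APGSetting.costC prm + 2)
        * (√(prm.Lmin + prm.γ₁) * √(P.Lφ x0 xg Δ₁ / ε)) * ℓ * (7 * ℓ) := by gcongr
    _ = _ := by unfold Lφ; ring

end Admissible

/-- All sufficiently small `ε` satisfy the smallness requirements. -/
theorem exists_eps_bound (P : Bilevel n) {prm : APGParams} (hL : 0 < prm.Lmin)
    {Δ₁ D : ℝ} (hΔ : 0 < Δ₁) (hD : 1 ≤ D) : ∃ ε₀ : ℝ, 0 < ε₀ ∧ ε₀ ≤ 1 ∧ ∀ ε, 0 < ε → ε < ε₀ →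
      ε ≤ 1 / 4 ∧ 4 * ε ≤ prm.Lmin ∧ ε * D ≤ Δ₁ ∧ ε * D * Δ₁ ≤ 1 ∧ 2 * D * ε ≤ 1 ∧
      4 * (max prm.Lmin (prm.γ₁ * (P.Lg₁ + 2 * D * P.Lf₁ + 1))) ^ 3 * D ^ 2 * ε ≤ prm.Lmin := by
  set K := max prm.Lmin (prm.γ₁ * (P.Lg₁ + 2 * D * P.Lf₁ + 1))
  have hD0 : 0 < D := by linarith
  have hK0 : 0 < K := hL.trans_le (le_max_left _ _)
  have key : ∀ {k r : ℝ}, 0 < k → 0 < r → ∀ᶠ ε in nhdsWithin (0 : ℝ) (Set.Ioi 0), k * ε ≤ r := by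
    intro k r hk hr
    filter_upwards [Ioo_mem_nhdsGT (div_pos hr hk)] with ε hε
    have := (lt_div_iff₀ hk).1 hε.2
    linarith
  have hev : ∀ᶠ ε in nhdsWithin (0 : ℝ) (Set.Ioi 0), ε ≤ 1 / 4 ∧ 4 * ε ≤ prm.Lmin ∧ ε * D ≤ Δ₁ ∧
      ε * D * Δ₁ ≤ 1 ∧ 2 * D * ε ≤ 1 ∧ 4 * K ^ 3 * D ^ 2 * ε ≤ prm.Lmin := by
    filter_upwards [key (k := 4) (r := 1) (by norm_num) one_pos, key (k := 4) (by norm_num) hL,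
      key hD0 hΔ, key (mul_pos hD0 hΔ) one_pos, key (k := 2 * D) (by positivity) one_pos,
      key (k := 4 * K ^ 3 * D ^ 2) (by positivity) hL] with ε h1 h2 h3 h4 h5 h6
    exact ⟨by linarith, h2, by linarith, by linarith, h5, h6⟩
  obtain ⟨ε₁, hε₁, hsub⟩ := mem_nhdsGT_iff_exists_Ioo_subset.1 hev
  refine ⟨min ε₁ 1, lt_min hε₁ one_pos, min_le_right _ _, fun ε h0 h1 => ?_⟩
  exact hsub ⟨h0, h1.trans_le (min_le_left _ _)⟩

end Bilevel

end

theorem lemma7 (prm : APGParams) (hLmin : 0 < prm.Lmin) (hγ₁ : 1 < prm.γ₁) (hγ₂ : 1 ≤ prm.γ₂) :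
    ∃ C : ℝ, 0 < C ∧
      ∀ (n : ℕ) (P : Bilevel n), P.BasicAssumption →
      ∀ Δ₁ : ℝ, 0 < Δ₁ → ∀ D : ℝ,
      ∃ ε₀ : ℝ, 0 < ε₀ ∧ ε₀ ≤ 1 ∧
      ∀ ε : ℝ, 0 < ε → ε < ε₀ →
      ∀ (x0 xg : Eucl n) (c : ℝ),
        P.RegularCondition x0 xg ε c Δ₁ →
        P.BoundedLevels prm.γ₁ x0 xg Δ₁ →
        P.Dz x0 xg Δ₁ ≤ D → P.Dg prm.γ₁ x0 xg Δ₁ ≤ D →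
        -- the interval search halts, so that the bisection has an input
        (∀ (σ : ℝ) (w : Eucl n), 0 < σ → σ ≤ 2 * P.Dz x0 xg Δ₁ →
            w ∈ P.levDL prm.γ₁ x0 xg Δ₁ →
            ∃ (a b : ℝ) (xb : Eucl n), P.RunIntV prm x0 xg ε c Δ₁ σ w a b xb) ∧
        -- the bisection halts, with a KKT point, within the stated number of oracle queries
        (∀ (a b : ℝ) (xb w : Eucl n), P.BisecInput prm x0 xg ε c Δ₁ a b xb →
            w ∈ P.levDL prm.γ₁ x0 xg Δ₁ →
            (∃ (x : Eucl n) (z : ℝ) (N : ℕ), P.RunBisec prm x0 xg ε c Δ₁ a b xb w x z N) ∧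
            ∀ (x : Eucl n) (z : ℝ) (N : ℕ), P.RunBisec prm x0 xg ε c Δ₁ a b xb w x z N →
              P.IsKKTPoint x0 ε c
                (max (P.tol₂ prm.γ₁ x0 xg Δ₁ ε) (P.tol₃ prm.γ₁ x0 xg Δ₁ ε)) x ∧
              P.KKTConditions x0 ε c
                (max (P.tol₂ prm.γ₁ x0 xg Δ₁ ε) (P.tol₃ prm.γ₁ x0 xg Δ₁ ε)) x z ∧
              (N : ℝ) ≤ C * √((P.Lg₁ + 2 * P.Dz x0 xg Δ₁ * P.Lf₁ + 1) / ε) * |Real.log ε| ^ 2) := by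
  have hlogγ : 0 < Real.log prm.γ₁ := Real.log_pos hγ₁
  have hC : 0 < APGSetting.costC prm := by
    unfold APGSetting.costC APGSetting.costB APGSetting.costA; positivity
  refine ⟨7 * (6 * APGSetting.costC prm + 2) * √(prm.Lmin + prm.γ₁), by positivity, ?_⟩
  intro n P hP Δ₁ hΔ D
  -- The given `D` is arbitrary, possibly nonpositive, so it is enlarged to `max D 1`.
  obtain ⟨ε₀, h0, h1, hsmall⟩ := P.exists_eps_bound hLmin hΔ (le_max_right D 1)
  refine ⟨ε₀, h0, h1, fun ε hε hε₀ x0 xg c hreg hbdd hDz hDg => ?_⟩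
  obtain ⟨a1, a2, a3, a4, a5, a6⟩ := hsmall ε hε hε₀
  have A : P.Admissible prm x0 xg ε c Δ₁ (max D 1) :=
    { basic := hP, Lmin_pos := hLmin, one_lt := hγ₁, one_le := hγ₂, gap_pos := hΔ, reg := hreg,
      bdd := hbdd, one_le_D := le_max_right _ _, Dz_le := hDz.trans (le_max_left _ _),
      Dg_le := hDg.trans (le_max_left _ _), eps_pos := hε, eps_le := a1, four_mul_le := a2,
      mul_D_le := a3, mul_D_mul_le := a4, two_mul_le := a5,
      energy_small := a6 }
  refine ⟨fun σ w hσ hσ2 _ => A.exists_runIntV w hσ hσ2, fun a b xb w hin hw => ?_⟩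
  obtain ⟨hbr, hlow⟩ := A.bisecInput hin
  refine ⟨A.exists_runBisec xb w hbr.nonneg hbr.le hbr.le_Dz, fun x z N hrun => ?_⟩
  obtain ⟨hkkt, hN⟩ := A.runBisec hrun hbr hlow hw
  exact ⟨⟨z, hkkt⟩, hkkt, hN.trans (A.totalCost_le hbr.nonneg hbr.le hbr.le_Dz)⟩
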